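/- Let $n\ge 1$ and let $(M^n,g)$ be a nonempty compact smooth Riemannian manifold without boundary, with Riemannian distance $|x-y|_g$ and Riemannian volume measure $dV$. (If $M$ is disconnected, points in different components are at distance $\infty$, and $\infty^{\alpha-n}=0$.) Let $0<\alpha<n$, $1<p<\frac n\alpha$, and let $q$ be given by $\frac1q=\frac1p-\frac\alpha n$. For real-valued functions $f$ put $$I_\alpha f(x)=\int_{M}\frac{f(y)}{|x-y|_g^{\,n-\alpha}}\,dV_y,\qquad N_{p,\alpha,M}=\sup\Bigl\{\frac{\|I_\alpha f\|_{L^q(M)}}{\|f\|_{L^p(M)}}:\ f\in L^p(M)\setminus\{0\}\Bigr\},$$ and let $N_{p,\alpha}$ be the same supremum for $\mathbb{R}^n$ with the Euclidean distance and Lebesgue measure. Then $$N_{p,\alpha,M}\ \ge\ N_{p,\alpha}.$$ -/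

import Mathlib

open MeasureTheory Set Bundle
open scoped Manifold ContDiff ENNReal

noncomputable section

namespace HLS

section Potential

variable {X : Type*} [EMetricSpace X] [MeasurableSpace X]

/-- The Riesz-type potential `I_α f (x) = ∫ f(y) |x - y|^(α - n) dμ(y)` on a metric measure space
of dimension `n`. The power is taken in `[0, ∞]`, so that the kernel is `0` for points at infinite
distance (points in different components of a Riemannian manifold); the value on the diagonal,
a null set, is irrelevant. -/
def potential (n : ℕ) (α : ℝ) (μ : Measure X) (f : X → ℝ) (x : X) : ℝ :=
  ∫ y, f y * (edist x y ^ (α - n)).toReal ∂μ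

/-- The sharp constant
`sup { ‖I_α f‖_{L^q} / ‖f‖_{L^p} : f ∈ L^p, f ≠ 0 }`, as an element of `[0, ∞]`. -/
def sharpConst (n : ℕ) (α p q : ℝ) (μ : Measure X) : ℝ≥0∞ :=
  ⨆ (f : X → ℝ) (_ : MemLp f (ENNReal.ofReal p) μ) (_ : eLpNorm f (ENNReal.ofReal p) μ ≠ 0),
    eLpNorm (potential n α μ f) (ENNReal.ofReal q) μ / eLpNorm f (ENNReal.ofReal p) μ

end Potential

section Volume

variable {n : ℕ} {M : Type*} [TopologicalSpace M] [ChartedSpace (EuclideanSpace ℝ (Fin n)) M]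
  [RiemannianBundle (fun x : M ↦ TangentSpace (𝓡 n) x)]

/-- The coordinate vector field `∂_i` of the chart `e`, at the point with coordinates `z`. -/
def coordVector (e : OpenPartialHomeomorph M (EuclideanSpace ℝ (Fin n)))
    (z : EuclideanSpace ℝ (Fin n)) (i : Fin n) : TangentSpace (𝓡 n) (e.symm z) :=
  mfderiv (𝓡 n) (𝓡 n) e.symm z (EuclideanSpace.single i (1 : ℝ) : EuclideanSpace ℝ (Fin n))

/-- The matrix `g_ij = g(∂_i, ∂_j)` of the Riemannian metric in the chart `e`, at the point with
coordinates `z`. -/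
def metricMatrix (e : OpenPartialHomeomorph M (EuclideanSpace ℝ (Fin n)))
    (z : EuclideanSpace ℝ (Fin n)) : Matrix (Fin n) (Fin n) ℝ :=
  Matrix.of fun i j ↦ inner ℝ (coordVector e z i) (coordVector e z j)

variable [MeasurableSpace M]

/-- The Riemannian volume of the domain of the chart `e`, extended by zero to `M`: the image under
the inverse of the chart of the measure `√(det g_ij) dz` on the target of the chart. -/
def chartVolume (e : OpenPartialHomeomorph M (EuclideanSpace ℝ (Fin n))) : Measure M :=
  ((volume.restrict e.target).withDensity
    fun z ↦ ENNReal.ofReal (√(metricMatrix e z).det)).map e.symm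

variable (n M) in
/-- The Riemannian volume measure `dV` on `M`. The volumes of the chart domains agree on overlaps
by the change of variables formula, and `dV` is the measure they glue to: the least measure
that dominates all of them. -/
def riemannianVolume : Measure M :=
  ⨆ x : M, chartVolume (chartAt (EuclideanSpace ℝ (Fin n)) x)

end Volume

end HLS

end

/-!
The Hardy-Littlewood-Sobolev quotient is invariant under dilations of Euclidean space, so test
functions on Euclidean space can be concentrated in arbitrarily small balls; and small balls of a
Riemannian manifold are almost Euclidean. Hence every Euclidean test function, transplanted to a
small ball of `M`, gives almost the same quotient there.

* Geometry. A linear change of a chart makes the metric Euclidean at the origin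
  (`exists_chart_metricMatrix_eq_one`), hence nearly Euclidean on a small ball, which is rescaled to
  the ball of radius `R`. There the distance of `M` is at most `K t` times the Euclidean one
  (coordinate segments, `edist_symm_le`) and at least a positive multiple of it
  (`exists_le_edist_symm`), and the volume of `M` is `t ^ n` times Lebesgue measure, up to a factor
  `K`. The last point needs that the supremum of the chart volumes is, on a chart domain, the volume
  of that chart (`riemannianVolume_restrict_chartAt_source`), which is the change of variables
  formula. The outcome is `exists_isNearlyEuclidean`.
* Transplantation. For bounded `g ≥ 0` supported in the ball, the upper bound for the distance
  bounds the potential on `M` of the transplanted function from below by the Euclidean potential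
  (`IsNearlyEuclidean.lpotential_le`). The lower bound for the distance serves only to make the
  integral on `M` converge: a divergent one would be `0` by convention. In the inequality for the
  norms the powers of `t` cancel (`distortion_const_eq`), and `K → 1` gives the inequality with the
  constant of `M` (`sharpConst_volume_le`).
* Truncation. By monotone convergence and Fatou's lemma, the inequality for bounded functions
  supported in balls implies it on all of `L^p` (`eLpNorm_potential_le_of_bounded`).
-/

noncomputable section

namespace HLS

open Filter Topology
open scoped NNReal

/-! ### Suprema of measures -/

section Measure

variable {X : Type*} [MeasurableSpace X]

/-- The supremum of measures is not a setwise supremum, and is used only as a least upper bound: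
`ν` becomes an upper bound when it is made infinite off `s`. -/
theorem iSup_restrict_le {ι : Type*} {μ : ι → Measure X} {ν : Measure X} {s : Set X}
    (hs : MeasurableSet s) (h : ∀ i, (μ i).restrict s ≤ ν) : (⨆ i, μ i).restrict s ≤ ν := by
  have key : ⨆ i, μ i ≤ ν + (⊤ : Measure X).restrict sᶜ := by
    refine iSup_le fun i ↦ ?_
    rw [← Measure.restrict_add_restrict_compl (μ := μ i) hs]
    gcongr
    · exact h i
    · exact le_top
  calc (⨆ i, μ i).restrict s ≤ (ν + (⊤ : Measure X).restrict sᶜ).restrict s :=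
        Measure.restrict_mono le_rfl key
    _ = ν.restrict s := by
        rw [Measure.restrict_add, Measure.restrict_restrict hs]
        simp
    _ ≤ ν := Measure.restrict_le_self

end Measure

/-! ### Continuously differentiable charts -/

section Smooth

variable {n : ℕ} {M : Type*} [TopologicalSpace M] [ChartedSpace (EuclideanSpace ℝ (Fin n)) M]

/-- A chart with values in Euclidean space that is continuously differentiable in both
directions. -/
structure IsC1Chart (e : OpenPartialHomeomorph M (EuclideanSpace ℝ (Fin n))) : Prop where
  contMDiffOn : ContMDiffOn (𝓡 n) (𝓡 n) 1 e e.source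
  contMDiffOn_symm : ContMDiffOn (𝓡 n) (𝓡 n) 1 e.symm e.target

variable {e e' : OpenPartialHomeomorph M (EuclideanSpace ℝ (Fin n))}

theorem isC1Chart_chartAt [IsManifold (𝓡 n) ∞ M] (x : M) :
    IsC1Chart (chartAt (EuclideanSpace ℝ (Fin n)) x) := by
  have : IsManifold (𝓡 n) 1 M := .of_le (n := ∞) (by norm_cast)
  exact ⟨contMDiffOn_chart, contMDiffOn_chart_symm⟩

theorem IsC1Chart.transHomeomorph (he : IsC1Chart e)
    {h : EuclideanSpace ℝ (Fin n) ≃ₜ EuclideanSpace ℝ (Fin n)}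
    (hh : ContDiff ℝ 1 h) (hh' : ContDiff ℝ 1 h.symm) : IsC1Chart (e.transHomeomorph h) := by
  refine ⟨hh.contMDiff.comp_contMDiffOn he.contMDiffOn, ?_⟩
  exact he.contMDiffOn_symm.comp hh'.contMDiff.contMDiffOn (fun z hz ↦ by simpa using hz)

theorem IsC1Chart.mdifferentiableAt_symm (he : IsC1Chart e) {z : EuclideanSpace ℝ (Fin n)}
    (hz : z ∈ e.target) : MDifferentiableAt (𝓡 n) (𝓡 n) e.symm z :=
  ((he.contMDiffOn_symm z hz).contMDiffAt (e.open_target.mem_nhds hz)).mdifferentiableAt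
    one_ne_zero

theorem IsC1Chart.mdifferentiableAt (he : IsC1Chart e) {x : M}
    (hx : x ∈ e.source) : MDifferentiableAt (𝓡 n) (𝓡 n) e x :=
  ((he.contMDiffOn x hx).contMDiffAt (e.open_source.mem_nhds hx)).mdifferentiableAt
    one_ne_zero

theorem IsC1Chart.differentiableAt_coordChange (he : IsC1Chart e) (he' : IsC1Chart e')
    {z : EuclideanSpace ℝ (Fin n)} (hz : z ∈ e'.target) (hz' : e'.symm z ∈ e.source) :
    DifferentiableAt ℝ (e ∘ e'.symm) z :=
  ((he.mdifferentiableAt hz').comp z (he'.mdifferentiableAt_symm hz)).differentiableAt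

end Smooth

/-! ### The metric and the volume in coordinates -/

section Metric

variable {n : ℕ} {M : Type*} [TopologicalSpace M] [ChartedSpace (EuclideanSpace ℝ (Fin n)) M]
  [RiemannianBundle (fun x : M ↦ TangentSpace (𝓡 n) x)]
  {e e' : OpenPartialHomeomorph M (EuclideanSpace ℝ (Fin n))}

/-- The Riemannian metric at `x`, on two vectors of the model space. All tangent spaces are copies
of the model space, so this form can be moved along an equality of base points. -/
def tangentInner (x : M) (v w : EuclideanSpace ℝ (Fin n)) : ℝ :=
  inner ℝ (show TangentSpace (𝓡 n) x from v) (show TangentSpace (𝓡 n) x from w)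

/-- The differential of the inverse chart as a linear map of the model space. -/
def symmDeriv (e : OpenPartialHomeomorph M (EuclideanSpace ℝ (Fin n)))
    (z : EuclideanSpace ℝ (Fin n)) : EuclideanSpace ℝ (Fin n) →ₗ[ℝ] EuclideanSpace ℝ (Fin n) :=
  (mfderiv (𝓡 n) (𝓡 n) e.symm z).toLinearMap

theorem tangentInner_sum_left {ι : Type*} (s : Finset ι) (x : M)
    (v : ι → EuclideanSpace ℝ (Fin n)) (w : EuclideanSpace ℝ (Fin n)) :
    tangentInner x (∑ i ∈ s, v i) w = ∑ i ∈ s, tangentInner x (v i) w :=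
  sum_inner (𝕜 := ℝ) (E := TangentSpace (𝓡 n) x) s v w

theorem tangentInner_sum_right {ι : Type*} (s : Finset ι) (x : M)
    (w : EuclideanSpace ℝ (Fin n)) (v : ι → EuclideanSpace ℝ (Fin n)) :
    tangentInner x w (∑ i ∈ s, v i) = ∑ i ∈ s, tangentInner x w (v i) :=
  inner_sum (𝕜 := ℝ) (E := TangentSpace (𝓡 n) x) s v w

theorem tangentInner_smul_left (x : M) (c : ℝ) (v w : EuclideanSpace ℝ (Fin n)) :
    tangentInner x (c • v) w = c * tangentInner x v w :=
  real_inner_smul_left (F := TangentSpace (𝓡 n) x) v w c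

theorem tangentInner_smul_right (x : M) (c : ℝ) (v w : EuclideanSpace ℝ (Fin n)) :
    tangentInner x v (c • w) = c * tangentInner x v w :=
  real_inner_smul_right (F := TangentSpace (𝓡 n) x) v w c

theorem metricMatrix_apply (z : EuclideanSpace ℝ (Fin n)) (i j : Fin n) :
    metricMatrix e z i j = tangentInner (e.symm z)
      (symmDeriv e z (EuclideanSpace.single i 1)) (symmDeriv e z (EuclideanSpace.single j 1)) :=
  rfl

theorem eq_sum_single (v : EuclideanSpace ℝ (Fin n)) :
    v = ∑ i, v i • EuclideanSpace.single i (1 : ℝ) := by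
  ext j
  simp [Pi.single_apply]

/-- In coordinates, the metric is the bilinear form of `metricMatrix`. -/
theorem tangentInner_symmDeriv (z v w : EuclideanSpace ℝ (Fin n)) :
    tangentInner (e.symm z) (symmDeriv e z v) (symmDeriv e z w) =
      ∑ i, ∑ j, v i * w j * metricMatrix e z i j := by
  conv_lhs => rw [eq_sum_single v, eq_sum_single w]
  simp only [map_sum, map_smul, tangentInner_sum_left, tangentInner_sum_right,
    tangentInner_smul_left, tangentInner_smul_right, metricMatrix_apply, Finset.mul_sum]
  rw [Finset.sum_comm]
  refine Finset.sum_congr rfl fun i _ ↦ Finset.sum_congr rfl fun j _ ↦ ?_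
  ring

omit [RiemannianBundle (fun x : M ↦ TangentSpace (𝓡 n) x)] in
theorem symmDeriv_comp_coordChange (he : IsC1Chart e) (he' : IsC1Chart e')
    {z : EuclideanSpace ℝ (Fin n)} (hz : z ∈ e'.target) (hz' : e'.symm z ∈ e.source)
    (v : EuclideanSpace ℝ (Fin n)) :
    symmDeriv e' z v = symmDeriv e (e (e'.symm z)) (fderiv ℝ (e ∘ e'.symm) z v) := by
  have hev : (e.symm ∘ (e ∘ e'.symm)) =ᶠ[𝓝 z] e'.symm := by
    have : e'.symm ⁻¹' e.source ∈ 𝓝 z :=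
      (e'.continuousAt_symm hz).preimage_mem_nhds (e.open_source.mem_nhds hz')
    filter_upwards [this] with y hy
    exact e.left_inv hy
  have h1 : mfderiv (𝓡 n) (𝓡 n) (e.symm ∘ (e ∘ e'.symm)) z = mfderiv (𝓡 n) (𝓡 n) e'.symm z :=
    hev.mfderiv_eq
  have h2 := mfderiv_comp z (he.mdifferentiableAt_symm (e.map_source hz'))
    (he.differentiableAt_coordChange he' hz hz').mdifferentiableAt
  rw [mfderiv_eq_fderiv] at h2
  -- both sides are maps into the tangent space at the same point up to propositional equality, so
  -- they are evaluated as maps of the model space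
  have h3 := h2.symm.trans h1
  exact (congrArg (fun L : EuclideanSpace ℝ (Fin n) →L[ℝ] EuclideanSpace ℝ (Fin n) ↦ L v) h3).symm

/-- The metric in two charts differs by the Jacobian matrix of the coordinate change. -/
theorem metricMatrix_coordChange (he : IsC1Chart e) (he' : IsC1Chart e')
    {z : EuclideanSpace ℝ (Fin n)} (hz : z ∈ e'.target) (hz' : e'.symm z ∈ e.source)
    (J : Matrix (Fin n) (Fin n) ℝ)
    (hJ : ∀ k i, J k i = fderiv ℝ (e ∘ e'.symm) z (EuclideanSpace.single i 1) k) :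
    metricMatrix e' z = J.transpose * metricMatrix e (e (e'.symm z)) * J := by
  ext i j
  rw [metricMatrix_apply, symmDeriv_comp_coordChange he he' hz hz',
    symmDeriv_comp_coordChange he he' hz hz']
  have h := tangentInner_symmDeriv (e := e) (e (e'.symm z))
    (fderiv ℝ (e ∘ e'.symm) z (EuclideanSpace.single i 1))
    (fderiv ℝ (e ∘ e'.symm) z (EuclideanSpace.single j 1))
  rw [e.left_inv hz'] at h
  rw [h]
  simp only [Matrix.mul_apply, Matrix.transpose_apply, hJ, Finset.sum_mul]
  rw [Finset.sum_comm]
  refine Finset.sum_congr rfl fun i _ ↦ Finset.sum_congr rfl fun j _ ↦ ?_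
  ring

/-- The Riemannian volume density transforms by the Jacobian determinant. -/
theorem sqrt_det_metricMatrix_coordChange (he : IsC1Chart e) (he' : IsC1Chart e')
    {z : EuclideanSpace ℝ (Fin n)} (hz : z ∈ e'.target) (hz' : e'.symm z ∈ e.source) :
    √(metricMatrix e' z).det =
      |(fderiv ℝ (e ∘ e'.symm) z).det| * √(metricMatrix e (e (e'.symm z))).det := by
  set b := (EuclideanSpace.basisFun (Fin n) ℝ).toBasis
  set J := LinearMap.toMatrix b b (fderiv ℝ (e ∘ e'.symm) z).toLinearMap with hJ
  rw [metricMatrix_coordChange he he' hz hz' J (fun k i ↦ by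
    simp [hJ, LinearMap.toMatrix_apply, b]), Matrix.det_mul, Matrix.det_mul, Matrix.det_transpose,
    show J.det * (metricMatrix e (e (e'.symm z))).det * J.det =
      J.det ^ 2 * (metricMatrix e (e (e'.symm z))).det by ring,
    Real.sqrt_mul (sq_nonneg _), Real.sqrt_sq_eq_abs, hJ, LinearMap.det_toMatrix]

variable [MeasurableSpace M] [BorelSpace M]

omit [ChartedSpace (EuclideanSpace ℝ (Fin n)) M]
  [RiemannianBundle (fun x : M ↦ TangentSpace (𝓡 n) x)] in
theorem measurableSet_target_inter_preimage {s : Set M} (hs : MeasurableSet s) :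
    MeasurableSet (e.target ∩ e.symm ⁻¹' s) := by
  have : Measurable (e.target.domRestrict e.symm) :=
    (continuousOn_iff_continuous_domRestrict.1 e.continuousOn_symm).measurable
  have h2 := e.open_target.measurableSet.subtype_image (this hs)
  convert h2 using 1
  ext z
  simp [Set.domRestrict, and_comm]

/-- The chart volume of a set, computed in coordinates. -/
theorem chartVolume_apply {s : Set M} (hs : MeasurableSet s) :
    chartVolume e s =
      ∫⁻ z in e.target ∩ e.symm ⁻¹' s, ENNReal.ofReal (√(metricMatrix e z).det) := by
  have hm : AEMeasurable e.symm (volume.restrict e.target) :=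
    e.continuousOn_symm.aemeasurable e.open_target.measurableSet
  rw [chartVolume, Measure.map_apply_of_aemeasurable
    (hm.mono_ac (withDensity_absolutelyContinuous _ _)) hs,
    withDensity_apply₀ _ (hm.nullMeasurable hs), Measure.restrict_restrict₀ (hm.nullMeasurable hs),
    inter_comm]

/-- The volumes of two charts agree on the overlap of their domains. -/
theorem chartVolume_eq_of_subset (he : IsC1Chart e) (he' : IsC1Chart e') {s : Set M}
    (hs : MeasurableSet s) (hse : s ⊆ e.source) (hse' : s ⊆ e'.source) :
    chartVolume e' s = chartVolume e s := by
  rw [chartVolume_apply hs, chartVolume_apply hs]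
  have himg : (e ∘ e'.symm) '' (e'.target ∩ e'.symm ⁻¹' s) = e.target ∩ e.symm ⁻¹' s := by
    ext w
    constructor
    · rintro ⟨z, ⟨hz, hzs⟩, rfl⟩
      exact ⟨e.map_source (hse hzs), by simpa [e.left_inv (hse hzs)] using hzs⟩
    · rintro ⟨hw, hws⟩
      refine ⟨e' (e.symm w), ⟨e'.map_source (hse' hws), ?_⟩, ?_⟩
      · simpa [e'.left_inv (hse' hws)] using hws
      · simp [e'.left_inv (hse' hws), e.right_inv hw]
  rw [← himg, lintegral_image_eq_lintegral_abs_det_fderiv_mul volume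
    (measurableSet_target_inter_preimage hs) (f' := fun z ↦ fderiv ℝ (e ∘ e'.symm) z)]
  · refine setLIntegral_congr_fun (measurableSet_target_inter_preimage hs) fun z hz ↦ ?_
    simp only [Function.comp_apply]
    rw [sqrt_det_metricMatrix_coordChange he he' hz.1 (hse hz.2),
      ENNReal.ofReal_mul (abs_nonneg _)]
  · exact fun z hz ↦
      (he.differentiableAt_coordChange he' hz.1 (hse hz.2)).hasFDerivAt.hasFDerivWithinAt
  · exact (e.injOn.comp (e'.symm.injOn.mono inter_subset_left) fun z hz ↦ hse hz.2)

theorem chartVolume_compl_source : chartVolume e e.sourceᶜ = 0 := by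
  rw [chartVolume_apply e.open_source.measurableSet.compl]
  have : e.target ∩ e.symm ⁻¹' e.sourceᶜ = ∅ := by
    ext z
    simpa using fun hz ↦ e.map_target hz
  rw [this, Measure.restrict_empty, lintegral_zero_measure]

theorem chartVolume_eq_of_source_eq (he : IsC1Chart e) (he' : IsC1Chart e')
    (h : e'.source = e.source) : chartVolume e' = chartVolume e := by
  have key : ∀ (e : OpenPartialHomeomorph M (EuclideanSpace ℝ (Fin n))) (s : Set M),
      chartVolume e s = chartVolume e (s ∩ e.source) := fun e s ↦
    (measure_inter_conull chartVolume_compl_source).symm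
  ext s hs
  rw [key e, key e', h]
  exact chartVolume_eq_of_subset he he' (hs.inter e.open_source.measurableSet)
    inter_subset_right (h ▸ inter_subset_right)

/-- In the domain of a chart the Riemannian volume is the volume of that chart. -/
theorem riemannianVolume_restrict_chartAt_source [IsManifold (𝓡 n) ∞ M] (x : M) :
    (riemannianVolume n M).restrict (chartAt (EuclideanSpace ℝ (Fin n)) x).source =
      chartVolume (chartAt (EuclideanSpace ℝ (Fin n)) x) := by
  set e := chartAt (EuclideanSpace ℝ (Fin n)) x
  have hsm : MeasurableSet e.source := e.open_source.measurableSet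
  apply le_antisymm
  · refine iSup_restrict_le hsm fun y ↦ Measure.le_iff.2 fun s hs ↦ ?_
    set e' := chartAt (EuclideanSpace ℝ (Fin n)) y
    rw [Measure.restrict_apply hs,
      ← measure_inter_conull (s := s ∩ e.source) (chartVolume_compl_source (e := e')),
      chartVolume_eq_of_subset (isC1Chart_chartAt x) (isC1Chart_chartAt y)
        ((hs.inter hsm).inter e'.open_source.measurableSet)
        (inter_subset_left.trans inter_subset_right) inter_subset_right]
    exact measure_mono (inter_subset_left.trans inter_subset_left)
  · calc chartVolume e = (chartVolume e).restrict e.source :=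
          (Measure.restrict_eq_self_of_ae_mem (by
            rw [ae_iff]; exact chartVolume_compl_source)).symm
      _ ≤ _ := Measure.restrict_mono le_rfl (le_iSup (fun x : M ↦
          chartVolume (chartAt (EuclideanSpace ℝ (Fin n)) x)) x)

end Metric

/-! ### Continuity and positivity of the metric in coordinates -/

section Metric

variable {n : ℕ} {M : Type*} [TopologicalSpace M] [ChartedSpace (EuclideanSpace ℝ (Fin n)) M]
  [RiemannianBundle (fun x : M ↦ TangentSpace (𝓡 n) x)]
  {e e' : OpenPartialHomeomorph M (EuclideanSpace ℝ (Fin n))}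

theorem continuousOn_metricMatrix [IsManifold (𝓡 n) 1 M]
    [IsContinuousRiemannianBundle (EuclideanSpace ℝ (Fin n))
      (fun x : M ↦ TangentSpace (𝓡 n) x)] (he : IsC1Chart e) :
    ContinuousOn (metricMatrix e) e.target := by
  have key : ∀ i, ContinuousOn (fun z ↦ (⟨e.symm z, coordVector e z i⟩ :
      TotalSpace (EuclideanSpace ℝ (Fin n)) (fun x : M ↦ TangentSpace (𝓡 n) x))) e.target := by
    intro i
    have h := he.contMDiffOn_symm.continuousOn_tangentMapWithin le_rfl
      e.open_target.uniqueMDiffOn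
    have hc : Continuous fun z : EuclideanSpace ℝ (Fin n) ↦
        (⟨z, EuclideanSpace.single i (1 : ℝ)⟩ : TangentBundle (𝓡 n) (EuclideanSpace ℝ (Fin n))) :=
      (tangentBundleModelSpaceHomeomorph (𝓡 n)).symm.continuous.comp
        (f := fun z : EuclideanSpace ℝ (Fin n) ↦
          ((z, EuclideanSpace.single i (1 : ℝ)) : ModelProd _ _))
        (continuous_id.prodMk continuous_const)
    refine (h.comp hc.continuousOn fun z hz ↦ hz).congr fun z hz ↦ ?_
    simp only [Function.comp_apply, tangentMapWithin, coordVector,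
      mfderivWithin_of_isOpen e.open_target hz]
  refine continuousOn_pi.2 fun i ↦ continuousOn_pi.2 fun j ↦ ?_
  exact ContinuousOn.inner_bundle (key i) (key j)

omit [RiemannianBundle (fun x : M ↦ TangentSpace (𝓡 n) x)] in
theorem symmDeriv_injective (he : IsC1Chart e) {z : EuclideanSpace ℝ (Fin n)}
    (hz : z ∈ e.target) : Function.Injective (symmDeriv e z) := by
  have hev : (e ∘ e.symm) =ᶠ[𝓝 z] id := by
    filter_upwards [e.open_target.mem_nhds hz] with y hy
    exact e.right_inv hy
  have h2 := mfderiv_comp z (he.mdifferentiableAt (e.map_target hz))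
    (he.mdifferentiableAt_symm hz)
  rw [hev.mfderiv_eq, mfderiv_id] at h2
  refine Function.LeftInverse.injective
    (g := (mfderiv (𝓡 n) (𝓡 n) e (e.symm z) : EuclideanSpace ℝ (Fin n) → _)) fun v ↦ ?_
  exact (congrArg (fun L : EuclideanSpace ℝ (Fin n) →L[ℝ] EuclideanSpace ℝ (Fin n) ↦ L v) h2).symm

theorem posDef_metricMatrix (he : IsC1Chart e) {z : EuclideanSpace ℝ (Fin n)}
    (hz : z ∈ e.target) : (metricMatrix e z).PosDef := by
  refine Matrix.PosDef.of_dotProduct_mulVec_pos ?_ fun v hv ↦ ?_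
  · ext i j
    exact real_inner_comm (F := TangentSpace (𝓡 n) (e.symm z)) _ _
  · have h := tangentInner_symmDeriv (e := e) z (WithLp.toLp 2 v) (WithLp.toLp 2 v)
    have hne : symmDeriv e z (WithLp.toLp 2 v) ≠ 0 := by
      rw [Ne, map_eq_zero_iff _ (symmDeriv_injective he hz)]
      simpa using hv
    have hpos : 0 < tangentInner (e.symm z) (symmDeriv e z (WithLp.toLp 2 v))
        (symmDeriv e z (WithLp.toLp 2 v)) :=
      real_inner_self_pos (F := TangentSpace (𝓡 n) (e.symm z)).2 hne
    rw [h] at hpos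
    refine hpos.trans_eq ?_
    simp only [dotProduct, Matrix.mulVec, Finset.mul_sum]
    refine Finset.sum_congr rfl fun i _ ↦ Finset.sum_congr rfl fun j _ ↦ ?_
    rw [Pi.star_apply, star_trivial]
    ring

end Metric

/-! ### Positive definite matrices -/

section Matrix
variable {ι : Type*} [Fintype ι] [DecidableEq ι]

/-- A positive definite matrix is congruent to the identity. -/
theorem exists_transpose_mul_mul_eq_one {G : Matrix ι ι ℝ} (hG : G.PosDef) :
    ∃ A : Matrix ι ι ℝ, IsUnit A.det ∧ A.transpose * G * A = 1 := by
  set U : Matrix ι ι ℝ := (hG.1.eigenvectorUnitary : Matrix ι ι ℝ)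
  set d := hG.1.eigenvalues
  have hd : ∀ i, 0 < d i := hG.eigenvalues_pos
  have hUU : U.transpose * U = 1 := by
    have := Unitary.coe_star_mul_self hG.1.eigenvectorUnitary
    simpa [Matrix.star_eq_conjTranspose] using this
  have hspec : G = U * Matrix.diagonal d * U.transpose := by
    have := hG.1.spectral_theorem
    rw [Unitary.conjStarAlgAut_apply] at this
    simpa [Matrix.star_eq_conjTranspose, Function.comp_def] using this
  -- the columns of the congruence are the eigenvectors divided by the roots of the eigenvalues
  have h1 : (U * Matrix.diagonal fun i ↦ (√(d i))⁻¹).transpose * G *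
      (U * Matrix.diagonal fun i ↦ (√(d i))⁻¹) = 1 := by
    rw [hspec, Matrix.transpose_mul, Matrix.diagonal_transpose]
    calc _ = Matrix.diagonal (fun i ↦ (√(d i))⁻¹) * (U.transpose * U) * Matrix.diagonal d *
          (U.transpose * U) * Matrix.diagonal (fun i ↦ (√(d i))⁻¹) := by
          simp only [Matrix.mul_assoc]
      _ = 1 := by
          rw [hUU, Matrix.mul_one, Matrix.mul_one, Matrix.diagonal_mul_diagonal,
            Matrix.diagonal_mul_diagonal, ← Matrix.diagonal_one]
          congr 1
          ext i
          have h0 : √(d i) ≠ 0 := (Real.sqrt_pos.2 (hd i)).ne'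
          field_simp
          exact (Real.sq_sqrt (hd i).le).symm
  refine ⟨_, ?_, h1⟩
  -- the determinant is invertible because that of the product is `1`
  have := congrArg Matrix.det h1
  rw [Matrix.det_mul, Matrix.det_one] at this
  exact IsUnit.of_mul_eq_one_right _ this

omit [DecidableEq ι] in
theorem abs_sum_sum_mul_le (v : EuclideanSpace ℝ ι) {D : Matrix ι ι ℝ} {η : ℝ}
    (hD : ∀ i j, |D i j| ≤ η) :
    |∑ i, ∑ j, v i * v j * D i j| ≤ Fintype.card ι ^ 2 * η * ‖v‖ ^ 2 := by
  have hv : ∀ i, |v i| ≤ ‖v‖ := fun i ↦ PiLp.norm_apply_le v i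
  calc |∑ i, ∑ j, v i * v j * D i j| ≤ ∑ i, ∑ j, |v i * v j * D i j| :=
        (Finset.abs_sum_le_sum_abs _ _).trans
          (Finset.sum_le_sum fun i _ ↦ Finset.abs_sum_le_sum_abs _ _)
    _ ≤ ∑ _i : ι, ∑ _j : ι, ‖v‖ * ‖v‖ * η := by
        refine Finset.sum_le_sum fun i _ ↦ Finset.sum_le_sum fun j _ ↦ ?_
        rw [abs_mul, abs_mul]
        have := hv i; have := hv j; have := hD i j
        gcongr
    _ = Fintype.card ι ^ 2 * η * ‖v‖ ^ 2 := by
        simp only [Finset.sum_const, Finset.card_univ, nsmul_eq_mul]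
        ring

end Matrix

/-! ### Charts in which the metric is nearly Euclidean -/

section Charts

variable {n : ℕ} {M : Type*} [TopologicalSpace M] [ChartedSpace (EuclideanSpace ℝ (Fin n)) M]
  [RiemannianBundle (fun x : M ↦ TangentSpace (𝓡 n) x)]
  {e e' : OpenPartialHomeomorph M (EuclideanSpace ℝ (Fin n))}

theorem metricMatrix_transHomeomorph (he : IsC1Chart e)
    {h : EuclideanSpace ℝ (Fin n) ≃ₜ EuclideanSpace ℝ (Fin n)}
    (hh : ContDiff ℝ 1 h) (hh' : ContDiff ℝ 1 h.symm) {z : EuclideanSpace ℝ (Fin n)}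
    (hz : h.symm z ∈ e.target) {J : Matrix (Fin n) (Fin n) ℝ}
    (hJ : ∀ k i, J k i = fderiv ℝ h.symm z (EuclideanSpace.single i 1) k) :
    metricMatrix (e.transHomeomorph h) z =
      J.transpose * metricMatrix e (h.symm z) * J := by
  have hs : (e.transHomeomorph h).symm z = e.symm (h.symm z) := rfl
  have hev : (e ∘ (e.transHomeomorph h).symm) =ᶠ[𝓝 z] h.symm := by
    filter_upwards [h.symm.continuous.continuousAt.preimage_mem_nhds
      (e.open_target.mem_nhds hz)] with y hy
    exact e.right_inv hy
  rw [metricMatrix_coordChange he (he.transHomeomorph hh hh') (z := z) hz (e.map_target hz) J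
    (by rw [hev.fderiv_eq]; exact hJ), hs, e.right_inv hz]

/-- An affine change of the chart at `x` makes the metric Euclidean at the origin. -/
theorem exists_chart_metricMatrix_eq_one [IsManifold (𝓡 n) ∞ M] (x : M) :
    ∃ e : OpenPartialHomeomorph M (EuclideanSpace ℝ (Fin n)), IsC1Chart e ∧
      e.source = (chartAt (EuclideanSpace ℝ (Fin n)) x).source ∧ 0 ∈ e.target ∧
      metricMatrix e 0 = 1 := by
  set e := chartAt (EuclideanSpace ℝ (Fin n)) x
  have he : IsC1Chart e := isC1Chart_chartAt x
  have hx : e x ∈ e.target := mem_chart_target _ x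
  obtain ⟨A, hA, hA1⟩ := exists_transpose_mul_mul_eq_one (posDef_metricMatrix he hx)
  set b := (EuclideanSpace.basisFun (Fin n) ℝ).toBasis with hb
  set L : EuclideanSpace ℝ (Fin n) ≃L[ℝ] EuclideanSpace ℝ (Fin n) :=
    (LinearEquiv.ofIsUnitDet (f := Matrix.toLin b b A) (v := b) (v' := b)
      (by rwa [LinearMap.toMatrix_toLin])).toContinuousLinearEquiv with hL
  have hLA : ∀ k i, A k i = L (EuclideanSpace.single i 1) k := by
    intro k i
    have h1 : L (EuclideanSpace.single i 1) = Matrix.toLin b b A (b i) := by simp [hL, hb]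
    have h2 : b.repr (Matrix.toLin b b A (b i)) k = A k i := by
      rw [Matrix.toLin_self]
      simp [Finsupp.single_apply]
    rw [h1, ← h2]
    simp [hb]
  set h := (Homeomorph.addRight (-(e x))).trans L.symm.toHomeomorph
  have hh : ContDiff ℝ 1 h := L.symm.contDiff.comp (contDiff_id.add contDiff_const)
  have hsymm : ∀ z, h.symm z = L z + e x := fun z ↦ by
    rw [Homeomorph.symm_apply_eq]
    simp [h]
  have hsymm' : ⇑h.symm = fun z ↦ L z + e x := funext hsymm
  have hh' : ContDiff ℝ 1 h.symm := by
    rw [hsymm']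
    exact L.contDiff.add contDiff_const
  have h0 : h.symm 0 = e x := by simp [hsymm]
  refine ⟨e.transHomeomorph h, he.transHomeomorph hh hh', rfl, ?_, ?_⟩
  · change h.symm 0 ∈ e.target
    rwa [h0]
  · rw [metricMatrix_transHomeomorph he hh hh' (J := A) (by rwa [h0]), h0, hA1]
    intro k i
    rw [hsymm', fderiv_add_const, L.fderiv, hLA]
    rfl

/-- The chart `t⁻¹ e`, which enlarges small balls around the origin. -/
def scaleChart (e : OpenPartialHomeomorph M (EuclideanSpace ℝ (Fin n))) {t : ℝ} (ht : t ≠ 0) :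
    OpenPartialHomeomorph M (EuclideanSpace ℝ (Fin n)) :=
  e.transHomeomorph (Homeomorph.smulOfNeZero t ht).symm

omit [RiemannianBundle (fun x : M ↦ TangentSpace (𝓡 n) x)] in
theorem IsC1Chart.scaleChart (he : IsC1Chart e) {t : ℝ} (ht : t ≠ 0) :
    IsC1Chart (scaleChart e ht) :=
  he.transHomeomorph (contDiff_const_smul t⁻¹) (contDiff_const_smul t)

theorem sqrt_det_metricMatrix_scaleChart (he : IsC1Chart e) {t : ℝ} (ht : 0 < t)
    {z : EuclideanSpace ℝ (Fin n)} (hz : t • z ∈ e.target) :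
    √(metricMatrix (scaleChart e ht.ne') z).det = t ^ n * √(metricMatrix e (t • z)).det := by
  rw [scaleChart, metricMatrix_transHomeomorph he (contDiff_const_smul t⁻¹)
    (contDiff_const_smul t) (J := t • (1 : Matrix (Fin n) (Fin n) ℝ)) hz]
  · simp only [Matrix.transpose_smul, Matrix.transpose_one, Matrix.smul_mul, Matrix.one_mul,
      Matrix.mul_smul, Matrix.mul_one, Matrix.det_smul, Fintype.card_fin, ← mul_assoc]
    rw [Real.sqrt_mul (by positivity), Real.sqrt_mul_self (by positivity)]
    rfl
  · intro k i
    have hf : fderiv ℝ (Homeomorph.smulOfNeZero t ht.ne').symm.symm z =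
        t • ContinuousLinearMap.id ℝ (EuclideanSpace ℝ (Fin n)) :=
      (t • ContinuousLinearMap.id ℝ (EuclideanSpace ℝ (Fin n))).hasFDerivAt.fderiv
    rw [hf]
    simp [Matrix.smul_apply, Matrix.one_apply]

/-- Near a point where the metric is Euclidean, it is nearly Euclidean. -/
theorem eventually_metricMatrix_near_one [IsManifold (𝓡 n) 1 M]
    [IsContinuousRiemannianBundle (EuclideanSpace ℝ (Fin n))
      (fun x : M ↦ TangentSpace (𝓡 n) x)] (he : IsC1Chart e)
    (h0 : 0 ∈ e.target) (h1 : metricMatrix e 0 = 1) {K : ℝ} (hK : 1 < K) :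
    ∀ᶠ z in 𝓝 (0 : EuclideanSpace ℝ (Fin n)), z ∈ e.target ∧
      (K⁻¹ ≤ √(metricMatrix e z).det ∧ √(metricMatrix e z).det ≤ K) ∧
      ∀ v, (K⁻¹ * ‖v‖) ^ 2 ≤
          tangentInner (e.symm z) (symmDeriv e z v) (symmDeriv e z v) ∧
        tangentInner (e.symm z) (symmDeriv e z v) (symmDeriv e z v) ≤ (K * ‖v‖) ^ 2 := by
  have hc : ContinuousAt (metricMatrix e) 0 :=
    (continuousOn_metricMatrix he).continuousAt (e.open_target.mem_nhds h0)
  have hdet : Tendsto (fun z ↦ √(metricMatrix e z).det) (𝓝 0) (𝓝 1) := by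
    have : ContinuousAt (fun z ↦ √(metricMatrix e z).det) 0 :=
      (Real.continuous_sqrt.comp (continuous_id.matrix_det)).continuousAt.comp hc
    simpa [ContinuousAt, h1] using this
  have hK1 : K⁻¹ < 1 := inv_lt_one_of_one_lt₀ hK
  have hK0 : 0 < K⁻¹ := by positivity
  -- the entries have to be within `η` of those of the identity, where `n ^ 2 * η ≤ 1 - K⁻¹ ^ 2`
  -- and `n ^ 2 * η ≤ K ^ 2 - 1`
  obtain ⟨η, hη, hη'⟩ : ∃ η > 0, (n : ℝ) ^ 2 * η ≤ min (1 - K⁻¹ ^ 2) (K ^ 2 - 1) := by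
    have hm : 0 < min (1 - K⁻¹ ^ 2) (K ^ 2 - 1) := lt_min (by nlinarith) (by nlinarith)
    refine ⟨min (1 - K⁻¹ ^ 2) (K ^ 2 - 1) / (n ^ 2 + 1), by positivity, ?_⟩
    rw [mul_div_assoc', div_le_iff₀ (by positivity)]
    nlinarith
  have hent : ∀ᶠ z in 𝓝 (0 : EuclideanSpace ℝ (Fin n)), ∀ i j,
      |(metricMatrix e z - 1) i j| ≤ η := by
    refine eventually_all.2 fun i ↦ eventually_all.2 fun j ↦ ?_
    have : Tendsto (fun z ↦ |(metricMatrix e z - 1) i j|) (𝓝 0) (𝓝 0) := by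
      have hg : Continuous fun B : Matrix (Fin n) (Fin n) ℝ ↦
          |(B - 1) i j| := by fun_prop
      have h2 : Tendsto _ _ _ := hg.continuousAt.comp hc
      simpa [Function.comp_def, h1] using h2
    exact this.eventually_le_const hη
  filter_upwards [e.open_target.mem_nhds h0, hdet.eventually_const_le hK1,
    hdet.eventually_le_const hK, hent] with z hz hd1 hd2 hz'
  refine ⟨hz, ⟨hd1, hd2⟩, fun v ↦ ?_⟩
  have hb := abs_sum_sum_mul_le v hz'
  have hsplit : ∑ i, ∑ j, v i * v j * (metricMatrix e z - 1) i j =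
      tangentInner (e.symm z) (symmDeriv e z v) (symmDeriv e z v) - ‖v‖ ^ 2 := by
    rw [tangentInner_symmDeriv, EuclideanSpace.real_norm_sq_eq]
    simp [mul_sub, Matrix.one_apply, Finset.sum_sub_distrib, sq]
  rw [hsplit, Fintype.card_fin, abs_le] at hb
  have hv : 0 ≤ ‖v‖ ^ 2 := by positivity
  have h2 := mul_le_mul_of_nonneg_right (hη'.trans (min_le_left _ _)) hv
  have h3 := mul_le_mul_of_nonneg_right (hη'.trans (min_le_right _ _)) hv
  constructor
  · rw [mul_pow]; linarith [hb.1]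
  · rw [mul_pow]; linarith [hb.2]

end Charts

/-! ### Comparison of distances -/

section Distance

theorem enorm_tangentSpace {n : ℕ} {M : Type*} [TopologicalSpace M]
    [ChartedSpace (EuclideanSpace ℝ (Fin n)) M]
    [RiemannianBundle (fun x : M ↦ TangentSpace (𝓡 n) x)] (x : M) (u : TangentSpace (𝓡 n) x) :
    ‖u‖ₑ = ENNReal.ofReal √(tangentInner x u u) := by
  rw [← ofReal_norm]
  exact congrArg ENNReal.ofReal (norm_eq_sqrt_real_inner (F := TangentSpace (𝓡 n) x) u)

variable {n : ℕ} {M : Type*} [EMetricSpace M] [ChartedSpace (EuclideanSpace ℝ (Fin n)) M]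
  [RiemannianBundle (fun x : M ↦ TangentSpace (𝓡 n) x)]
  {e : OpenPartialHomeomorph M (EuclideanSpace ℝ (Fin n))}

/-- If the metric is at most `K ^ 2` times the Euclidean one in coordinates, then distances are at
most `K` times the Euclidean ones, by comparison with the length of the coordinate segment. -/
theorem edist_symm_le [IsRiemannianManifold (𝓡 n) M] (he : IsC1Chart e) {K δ : ℝ}
    (hδ : ∀ z ∈ Metric.ball 0 δ, z ∈ e.target ∧
      ∀ v, tangentInner (e.symm z) (symmDeriv e z v) (symmDeriv e z v) ≤ (K * ‖v‖) ^ 2)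
    (hK : 0 ≤ K) {z w : EuclideanSpace ℝ (Fin n)} (hz : z ∈ Metric.ball 0 δ)
    (hw : w ∈ Metric.ball 0 δ) :
    edist (e.symm z) (e.symm w) ≤ ENNReal.ofReal K * edist z w := by
  rw [IsRiemannianManifold.out (I := 𝓡 n) (e.symm z) (e.symm w)]
  set η : ℝ → EuclideanSpace ℝ (Fin n) := fun t ↦ z + t • (w - z) with hη
  have hηd : ∀ t, HasDerivAt η (w - z) t := fun t ↦ by
    simpa [hη] using ((hasDerivAt_id t).smul_const (w - z)).const_add z
  have hηball : ∀ t ∈ Icc (0 : ℝ) 1, η t ∈ Metric.ball 0 δ := fun t ht ↦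
    (convex_ball 0 δ).add_smul_sub_mem hz hw ht
  have hηc : ContMDiff 𝓘(ℝ, ℝ) (𝓡 n) 1 η :=
    (contDiff_const.add (contDiff_id.smul contDiff_const)).contMDiff
  have hlen : Manifold.riemannianEDist (𝓡 n) (e.symm z) (e.symm w) ≤
      Manifold.pathELength (𝓡 n) (e.symm ∘ η) 0 1 := by
    refine Manifold.riemannianEDist_le_pathELength ?_ (by simp [hη]) (by simp [hη]) zero_le_one
    exact he.contMDiffOn_symm.comp hηc.contMDiffOn fun t ht ↦ (hδ _ (hηball t ht)).1
  refine hlen.trans ?_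
  rw [Manifold.pathELength_eq_lintegral_mfderiv_Icc]
  calc ∫⁻ t in Icc (0 : ℝ) 1, ‖mfderiv 𝓘(ℝ, ℝ) (𝓡 n) (e.symm ∘ η) t 1‖ₑ
      ≤ ∫⁻ t in Icc (0 : ℝ) 1, ENNReal.ofReal K * edist z w := by
        refine setLIntegral_mono' measurableSet_Icc fun t ht ↦ ?_
        have ht' := hδ _ (hηball t ht)
        have hcomp := mfderiv_comp t (he.mdifferentiableAt_symm ht'.1)
          (hηd t).differentiableAt.mdifferentiableAt
        rw [mfderiv_eq_fderiv] at hcomp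
        have hval : mfderiv 𝓘(ℝ, ℝ) (𝓡 n) (e.symm ∘ η) t 1 = symmDeriv e (η t) (w - z) := by
          have h1 : mfderiv 𝓘(ℝ, ℝ) (𝓡 n) (e.symm ∘ η) t 1 =
            symmDeriv e (η t) (fderiv ℝ η t 1) :=
            congrArg (fun L : ℝ →L[ℝ] EuclideanSpace ℝ (Fin n) ↦ L 1) hcomp
          rw [h1, fderiv_apply_one_eq_deriv, (hηd t).deriv]
        rw [enorm_tangentSpace, hval]
        calc _ ≤ ENNReal.ofReal (K * ‖w - z‖) :=
              ENNReal.ofReal_le_ofReal (Real.sqrt_le_iff.2 ⟨by positivity, ht'.2 _⟩)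
          _ = _ := by
              rw [ENNReal.ofReal_mul hK, edist_comm, edist_eq_enorm_sub, ofReal_norm]
    _ = ENNReal.ofReal K * edist z w := by simp

/-- If the metric is at least `c ^ 2` times the Euclidean one in coordinates, then distances of
nearby points are at least `c` times the Euclidean ones: a path of almost minimal length between
points close to the origin does not leave the ball where the lower bound holds. -/
theorem exists_le_edist_symm [IsRiemannianManifold (𝓡 n) M] (he : IsC1Chart e) {c δ : ℝ}
    (hδ0 : 0 < δ) (hc : 0 ≤ c)
    (hδ : ∀ z ∈ Metric.ball 0 δ, z ∈ e.target ∧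
      ∀ v, (c * ‖v‖) ^ 2 ≤ tangentInner (e.symm z) (symmDeriv e z v) (symmDeriv e z v)) :
    ∃ δ' > 0, ∀ z ∈ Metric.ball (0 : EuclideanSpace ℝ (Fin n)) δ', ∀ w ∈ Metric.ball 0 δ',
      ENNReal.ofReal c * edist z w ≤ edist (e.symm z) (e.symm w) := by
  have h0 : (0 : EuclideanSpace ℝ (Fin n)) ∈ e.target := (hδ 0 (by simpa)).1
  have hU : e.symm '' Metric.ball 0 δ ∈ 𝓝 (e.symm 0) :=
    e.symm.image_mem_nhds h0 (Metric.ball_mem_nhds 0 hδ0)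
  obtain ⟨r, hr0, hr⟩ := EMetric.mem_nhds_iff.1 hU
  -- points `z`, `w` at distance less than `ρ` from the origin are at distance less than `2 ρ`, and
  -- paths of length less than `2 ρ` from `z` stay within `3 ρ` of the origin
  obtain ⟨ρ, hρ0, hρ⟩ : ∃ ρ : ℝ≥0∞, 0 < ρ ∧ 3 * ρ ≤ r := by
    refine ⟨r / 3, by simp [hr0.ne'], ?_⟩
    rw [ENNReal.mul_div_cancel (by simp) (by simp)]
  have hV : e.symm ⁻¹' Metric.eball (e.symm 0) ρ ∈ 𝓝 (0 : EuclideanSpace ℝ (Fin n)) :=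
    (e.continuousAt_symm h0).preimage_mem_nhds (Metric.eball_mem_nhds _ hρ0)
  obtain ⟨δ₁, hδ₁0, hδ₁⟩ := Metric.mem_nhds_iff.1 hV
  refine ⟨min δ δ₁, lt_min hδ0 hδ₁0, fun z hz w hw ↦ ?_⟩
  have hzρ : edist (e.symm z) (e.symm 0) < ρ :=
    hδ₁ (Metric.ball_subset_ball (min_le_right _ _) hz)
  have hwρ : edist (e.symm w) (e.symm 0) < ρ :=
    hδ₁ (Metric.ball_subset_ball (min_le_right _ _) hw)
  have hzt : z ∈ e.target := (hδ _ (Metric.ball_subset_ball (min_le_left _ _) hz)).1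
  have hwt : w ∈ e.target := (hδ _ (Metric.ball_subset_ball (min_le_left _ _) hw)).1
  have hzw : edist (e.symm z) (e.symm w) < 2 * ρ := by
    calc _ ≤ edist (e.symm z) (e.symm 0) + edist (e.symm w) (e.symm 0) :=
          edist_triangle_right _ _ _
      _ < ρ + ρ := ENNReal.add_lt_add hzρ hwρ
      _ = 2 * ρ := (two_mul ρ).symm
  refine le_of_forall_gt fun s hs ↦ ?_
  have hs' : edist (e.symm z) (e.symm w) < min s (2 * ρ) := lt_min hs hzw
  rw [IsRiemannianManifold.out (I := 𝓡 n) (e.symm z) (e.symm w)] at hs'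
  obtain ⟨γ, hγ0, hγ1, hγ, hlen⟩ := Manifold.exists_lt_of_riemannianEDist_lt hs'
  refine lt_of_le_of_lt ?_ (hlen.trans_le (min_le_left _ _))
  have hγball : ∀ t ∈ Icc (0 : ℝ) 1, γ t ∈ e.symm '' Metric.ball 0 δ := fun t ht ↦ by
    apply hr
    have h1 : edist (γ t) (e.symm z) < 2 * ρ := by
      rw [edist_comm, IsRiemannianManifold.out (I := 𝓡 n) (e.symm z) (γ t)]
      calc _ ≤ Manifold.pathELength (𝓡 n) γ 0 t :=
            Manifold.riemannianEDist_le_pathELength (hγ.mono (Icc_subset_Icc le_rfl ht.2)) hγ0 rfl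
              ht.1
        _ ≤ Manifold.pathELength (𝓡 n) γ 0 1 := Manifold.pathELength_mono le_rfl ht.2
        _ < 2 * ρ := hlen.trans_le (min_le_right _ _)
    calc edist (γ t) (e.symm 0) ≤ edist (γ t) (e.symm z) + edist (e.symm z) (e.symm 0) :=
          edist_triangle _ _ _
      _ < 2 * ρ + ρ := ENNReal.add_lt_add h1 hzρ
      _ = 3 * ρ := by ring
      _ ≤ r := hρ
  have hγball' : ∀ t ∈ Icc (0 : ℝ) 1, e (γ t) ∈ Metric.ball 0 δ ∧ e.symm (e (γ t)) = γ t ∧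
      γ t ∈ e.source := fun t ht ↦ by
    obtain ⟨y, hy, hy'⟩ := hγball t ht
    rw [← hy', e.right_inv (hδ y hy).1]
    exact ⟨hy, rfl, e.map_target (hδ y hy).1⟩
  have hsm : ContMDiffOn 𝓘(ℝ, ℝ) (𝓡 n) 1 (e ∘ γ) (Icc 0 1) :=
    he.contMDiffOn.comp hγ fun t ht ↦ (hγball' t ht).2.2
  have hftc := enorm_sub_le_lintegral_derivWithin_Icc_of_contDiffOn_Icc
    (contMDiffOn_iff_contDiffOn.1 hsm) zero_le_one
  simp only [Function.comp_apply, hγ0, hγ1, e.right_inv hzt, e.right_inv hwt] at hftc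
  rw [edist_comm, edist_eq_enorm_sub, Manifold.pathELength_eq_lintegral_mfderiv_Icc,
    ← restrict_Ioo_eq_restrict_Icc]
  rw [← restrict_Ioo_eq_restrict_Icc] at hftc
  refine (mul_le_mul_right hftc _).trans ?_
  rw [← lintegral_const_mul' _ _ ENNReal.ofReal_ne_top]
  refine setLIntegral_mono' measurableSet_Ioo fun t ht ↦ ?_
  have htI : Icc (0 : ℝ) 1 ∈ 𝓝 t := Icc_mem_nhds ht.1 ht.2
  have ht' := hγball' t (Ioo_subset_Icc_self ht)
  have hd : DifferentiableAt ℝ (e ∘ γ) t :=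
    ((contMDiffOn_iff_contDiffOn.1 hsm).differentiableOn one_ne_zero).differentiableAt htI
  have hev : (e.symm ∘ (e ∘ γ)) =ᶠ[𝓝 t] γ := by
    filter_upwards [htI] with y hy
    exact (hγball' y hy).2.1
  have hcomp := mfderiv_comp t (he.mdifferentiableAt_symm (hδ _ ht'.1).1) hd.mdifferentiableAt
  rw [hev.mfderiv_eq, mfderiv_eq_fderiv] at hcomp
  have hval : mfderiv 𝓘(ℝ, ℝ) (𝓡 n) γ t 1 = symmDeriv e (e (γ t)) (deriv (e ∘ γ) t) := by
    have h1 : mfderiv 𝓘(ℝ, ℝ) (𝓡 n) γ t 1 =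
      symmDeriv e (e (γ t)) (fderiv ℝ (e ∘ γ) t 1) :=
      congrArg (fun L : ℝ →L[ℝ] EuclideanSpace ℝ (Fin n) ↦ L 1) hcomp
    rw [h1, fderiv_apply_one_eq_deriv]
  have hlow := (hδ _ ht'.1).2 (deriv (e ∘ γ) t)
  rw [ht'.2.1] at hlow
  rw [enorm_tangentSpace, hval, derivWithin_of_mem_nhds htI, ← ofReal_norm,
    ← ENNReal.ofReal_mul hc]
  exact ENNReal.ofReal_le_ofReal (Real.le_sqrt_of_sq_le hlow)

end Distance

/-! ### Nearly Euclidean balls -/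

section NearlyEuclidean

variable {n : ℕ} {M : Type*} [EMetricSpace M] [ChartedSpace (EuclideanSpace ℝ (Fin n)) M]
  [RiemannianBundle (fun x : M ↦ TangentSpace (𝓡 n) x)]
  {e : OpenPartialHomeomorph M (EuclideanSpace ℝ (Fin n))}

variable [MeasurableSpace M] [BorelSpace M]

theorem chartVolume_restrict_apply {U s : Set M} {B : Set (EuclideanSpace ℝ (Fin n))}
    (hB : B ⊆ e.target) (hU : U = e.symm '' B) (hUm : MeasurableSet U) (hs : MeasurableSet s) :
    (chartVolume e).restrict U s =
      ∫⁻ z in B ∩ e.symm ⁻¹' s, ENNReal.ofReal (√(metricMatrix e z).det) := by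
  rw [Measure.restrict_apply hs, chartVolume_apply (hs.inter hUm)]
  congr 2
  ext z
  constructor
  · rintro ⟨hz, hzs, hzU⟩
    rw [hU] at hzU
    obtain ⟨y, hy, hyz⟩ := hzU
    rw [e.symm.injOn (hB hy) hz hyz] at hy
    exact ⟨hy, hzs⟩
  · rintro ⟨hz, hzs⟩
    exact ⟨hB hz, hzs, hU ▸ mem_image_of_mem _ hz⟩

/-- A chart `e` of a metric measure space whose target contains the ball of radius `R` and which,
over that ball, is bi-Lipschitz with upper constant `a`, and distorts the measure by a factor
at most `m₁` in one direction and `m₂` in the other. -/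
structure IsNearlyEuclidean {X : Type*} [EMetricSpace X] [MeasurableSpace X] (μ : Measure X)
    (e : OpenPartialHomeomorph X (EuclideanSpace ℝ (Fin n))) (R : ℝ) (a m₁ m₂ : ℝ≥0∞) : Prop where
  ball_subset : Metric.ball 0 R ⊆ e.target
  edist_le : ∀ z ∈ Metric.ball (0 : EuclideanSpace ℝ (Fin n)) R, ∀ w ∈ Metric.ball 0 R,
    edist (e.symm z) (e.symm w) ≤ a * edist z w
  le_edist : ∃ c : ℝ≥0∞, c ≠ 0 ∧ c ≠ ⊤ ∧ ∀ z ∈ Metric.ball (0 : EuclideanSpace ℝ (Fin n)) R,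
    ∀ w ∈ Metric.ball 0 R, c * edist z w ≤ edist (e.symm z) (e.symm w)
  restrict_le : μ.restrict (e.symm '' Metric.ball 0 R) ≤
    m₁ • (volume.restrict (Metric.ball 0 R)).map e.symm
  map_le : (volume.restrict (Metric.ball 0 R)).map e.symm ≤
    m₂ • μ.restrict (e.symm '' Metric.ball 0 R)

/-- Small balls of a Riemannian manifold, rescaled to a fixed size, are as close to being
Euclidean as desired. -/
theorem exists_isNearlyEuclidean [IsManifold (𝓡 n) ∞ M]
    [IsContMDiffRiemannianBundle (𝓡 n) ∞ (EuclideanSpace ℝ (Fin n))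
      (fun x : M ↦ TangentSpace (𝓡 n) x)]
    [IsRiemannianManifold (𝓡 n) M] (x : M) {K : ℝ} (hK : 1 < K) {R : ℝ} (hR : 0 < R) :
    ∃ (e : OpenPartialHomeomorph M (EuclideanSpace ℝ (Fin n))) (t : ℝ), 0 < t ∧
      IsNearlyEuclidean (riemannianVolume n M) e R (ENNReal.ofReal (K * t))
        (ENNReal.ofReal (K * t ^ n)) (ENNReal.ofReal (K * (t ^ n)⁻¹)) := by
  have : IsManifold (𝓡 n) 1 M := .of_le (n := ∞) (by norm_cast)
  have : IsContinuousRiemannianBundle (EuclideanSpace ℝ (Fin n))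
      (fun x : M ↦ TangentSpace (𝓡 n) x) := by
    obtain ⟨g, hg, hg'⟩ := IsContMDiffRiemannianBundle.exists_contMDiff (IB := 𝓡 n) (n := ∞)
      (F := EuclideanSpace ℝ (Fin n)) (E := fun x : M ↦ TangentSpace (𝓡 n) x)
    exact ⟨g, hg.continuous, hg'⟩
  obtain ⟨e, he, hsrc, h0, h1⟩ := exists_chart_metricMatrix_eq_one (n := n) x
  obtain ⟨δ, hδ0, hδ⟩ := Metric.eventually_nhds_iff_ball.1
    (eventually_metricMatrix_near_one he h0 h1 hK)
  have hK0 : 0 < K := by positivity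
  obtain ⟨δ', hδ'0, hδ'⟩ := exists_le_edist_symm he (c := K⁻¹) hδ0 (by positivity)
    fun z hz ↦ ⟨(hδ z hz).1, fun v ↦ ((hδ z hz).2.2 v).1⟩
  set t := min δ δ' / R with ht
  have htR : t * R = min δ δ' := by rw [ht]; field_simp
  have ht0 : 0 < t := div_pos (lt_min hδ0 hδ'0) hR
  have hball : ∀ z ∈ Metric.ball (0 : EuclideanSpace ℝ (Fin n)) R,
      t • z ∈ Metric.ball (0 : EuclideanSpace ℝ (Fin n)) δ ∧
      t • z ∈ Metric.ball (0 : EuclideanSpace ℝ (Fin n)) δ' := by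
    intro z hz
    have : t • z ∈ Metric.ball (0 : EuclideanSpace ℝ (Fin n)) (min δ δ') := by
      rw [mem_ball_zero_iff] at hz ⊢
      rw [norm_smul, Real.norm_of_nonneg ht0.le, ← htR]
      gcongr
    exact ⟨Metric.ball_subset_ball (min_le_left _ _) this,
      Metric.ball_subset_ball (min_le_right _ _) this⟩
  have hedist : ∀ z w : EuclideanSpace ℝ (Fin n),
      edist (t • z) (t • w) = ENNReal.ofReal t * edist z w := by
    intro z w
    rw [edist_smul₀, ENNReal.smul_def, smul_eq_mul, ← enorm_eq_nnnorm,
      Real.enorm_of_nonneg ht0.le]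
  set e' := scaleChart e ht0.ne'
  have hsub : Metric.ball 0 R ⊆ e'.target := fun z hz ↦ (hδ _ (hball z hz).1).1
  have hUm : MeasurableSet (e'.symm '' Metric.ball 0 R) :=
    (e'.symm.isOpen_image_of_subset_source Metric.isOpen_ball hsub).measurableSet
  have hmeas : AEMeasurable e'.symm (volume.restrict (Metric.ball 0 R)) :=
    (e'.continuousOn_symm.mono hsub).aemeasurable measurableSet_ball
  have hvol : (riemannianVolume n M).restrict (e'.symm '' Metric.ball 0 R) =
      (chartVolume e').restrict (e'.symm '' Metric.ball 0 R) := by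
    rw [chartVolume_eq_of_source_eq (isC1Chart_chartAt x) (he.scaleChart ht0.ne') hsrc,
      ← riemannianVolume_restrict_chartAt_source, Measure.restrict_restrict hUm,
      inter_eq_self_of_subset_left]
    rw [← hsrc]
    rintro _ ⟨z, hz, rfl⟩
    exact e'.map_target (hsub hz)
  have hmap : ∀ s, MeasurableSet s → (volume.restrict (Metric.ball 0 R)).map e'.symm s =
      volume (Metric.ball 0 R ∩ e'.symm ⁻¹' s) := by
    intro s hs
    rw [Measure.map_apply_of_aemeasurable hmeas hs,
      Measure.restrict_apply₀ (hmeas.nullMeasurable hs), inter_comm]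
  have hden : ∀ z ∈ Metric.ball 0 R, √(metricMatrix e' z).det =
      t ^ n * √(metricMatrix e (t • z)).det := fun z hz ↦
    sqrt_det_metricMatrix_scaleChart he ht0 (hδ _ (hball z hz).1).1
  have hms : ∀ s, MeasurableSet s → MeasurableSet (Metric.ball 0 R ∩ e'.symm ⁻¹' s) := by
    intro s hs
    have := measurableSet_ball.inter (measurableSet_target_inter_preimage (e := e') hs)
      (s₁ := Metric.ball 0 R)
    rwa [← inter_assoc, inter_eq_self_of_subset_left hsub] at this
  refine ⟨e', t, ht0, hsub, ?_, ?_, ?_, ?_⟩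
  · intro z hz w hw
    refine (edist_symm_le he (fun z hz ↦ ⟨(hδ z hz).1, fun v ↦ ((hδ z hz).2.2 v).2⟩) hK0.le
      (hball z hz).1 (hball w hw).1).trans_eq ?_
    rw [hedist, ← mul_assoc, ENNReal.ofReal_mul hK0.le]
  · refine ⟨ENNReal.ofReal (K⁻¹ * t), by simp; positivity, ENNReal.ofReal_ne_top,
      fun z hz w hw ↦ ?_⟩
    have h := hδ' _ (hball z hz).2 _ (hball w hw).2
    rwa [hedist, ← mul_assoc, ← ENNReal.ofReal_mul (by positivity)] at h
  · rw [hvol]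
    refine Measure.le_iff.2 fun s hs ↦ ?_
    rw [chartVolume_restrict_apply hsub rfl hUm hs, Measure.smul_apply, hmap s hs, smul_eq_mul,
      ← setLIntegral_const]
    refine setLIntegral_mono' (hms s hs) fun z hz ↦ ENNReal.ofReal_le_ofReal ?_
    rw [hden z hz.1, mul_comm]
    have := (hδ _ (hball z hz.1).1).2.1.2
    gcongr
  · rw [hvol]
    refine Measure.le_iff.2 fun s hs ↦ ?_
    rw [Measure.smul_apply, chartVolume_restrict_apply hsub rfl hUm hs, hmap s hs, smul_eq_mul,
      ← lintegral_const_mul' _ _ ENNReal.ofReal_ne_top, ← setLIntegral_one]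
    refine setLIntegral_mono' (hms s hs) fun z hz ↦ ?_
    have := (hδ _ (hball z hz.1).1).2.1.1
    rw [hden z hz.1, ← ENNReal.ofReal_mul (by positivity), ← ENNReal.ofReal_one]
    refine ENNReal.ofReal_le_ofReal ?_
    calc (1 : ℝ) = K * (t ^ n)⁻¹ * (t ^ n * K⁻¹) := by field_simp
      _ ≤ _ := by gcongr

end NearlyEuclidean

/-! ### The potential of nonnegative functions on Euclidean space -/

section Euclidean

variable {n : ℕ} {α : ℝ}

theorem rpow_le_rpow_of_nonpos {x y : ℝ≥0∞} {r : ℝ} (hr : r ≤ 0) (h : x ≤ y) :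
    y ^ r ≤ x ^ r := by
  rw [← neg_neg r, ENNReal.rpow_neg y, ENNReal.rpow_neg x, ENNReal.inv_le_inv]
  exact ENNReal.rpow_le_rpow h (by linarith)

/-- The potential of a nonnegative function on Euclidean space, with values in `[0, ∞]`. -/
def lpotential (α : ℝ) (g : EuclideanSpace ℝ (Fin n) → ℝ≥0∞) (z : EuclideanSpace ℝ (Fin n)) :
    ℝ≥0∞ :=
  ∫⁻ w, g w * edist z w ^ (α - n)

theorem measurable_lpotential {g : EuclideanSpace ℝ (Fin n) → ℝ≥0∞} (hg : Measurable g) :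
    Measurable (lpotential α g) := by
  refine Measurable.lintegral_prod_right' (f := fun x : EuclideanSpace ℝ (Fin n) × _ ↦
    g x.2 * edist x.1 x.2 ^ (α - n)) ?_
  exact (hg.comp measurable_snd).mul ((measurable_fst.edist measurable_snd).pow_const _)

/-- The kernel `|z - w| ^ (α - n)` is locally integrable. -/
theorem setLIntegral_edist_rpow_lt_top (hα : 0 < α) (hn : 1 ≤ n)
    (z : EuclideanSpace ℝ (Fin n)) (R : ℝ) :
    ∫⁻ w in Metric.ball 0 R, edist z w ^ (α - n) < ⊤ := by
  have hfr : Module.finrank ℝ (EuclideanSpace ℝ (Fin n)) = n := by simp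
  have : Nonempty (Fin n) := ⟨⟨0, hn⟩⟩
  have hloc : IntegrableOn (fun u : EuclideanSpace ℝ (Fin n) ↦ ‖u‖ ^ (α - n))
      (Metric.ball 0 (R + ‖z‖)) := by
    refine integrableOn_ball_of_norm_le_rpow (C := 1) (α := n - α) (by rwa [hfr])
      (by rw [hfr]; linarith) (ae_of_all _ fun u ↦ ?_)
      (measurable_norm.pow_const _).aestronglyMeasurable
    rw [neg_sub, one_mul, Real.norm_of_nonneg (by positivity)]
  calc ∫⁻ w in Metric.ball 0 R, edist z w ^ (α - n)
      ≤ ∫⁻ w, (Metric.ball 0 (R + ‖z‖)).indicator (fun u ↦ ‖u‖ₑ ^ (α - n)) (z - w) := by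
        rw [← lintegral_indicator measurableSet_ball]
        refine lintegral_mono fun w ↦ indicator_apply_le' (fun hw ↦ ?_) fun _ ↦ bot_le
        rw [indicator_of_mem, edist_eq_enorm_sub]
        rw [mem_ball_zero_iff] at hw ⊢
        linarith [norm_sub_le z w]
    _ = ∫⁻ u in Metric.ball (0 : EuclideanSpace ℝ (Fin n)) (R + ‖z‖), ‖u‖ₑ ^ (α - n) := by
        rw [lintegral_sub_left_eq_self
          ((Metric.ball 0 (R + ‖z‖)).indicator fun u ↦ ‖u‖ₑ ^ (α - n)) z,
          lintegral_indicator measurableSet_ball]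
    _ = ∫⁻ u in Metric.ball (0 : EuclideanSpace ℝ (Fin n)) (R + ‖z‖), ‖‖u‖ ^ (α - n)‖ₑ := by
        refine lintegral_congr_ae (ae_restrict_of_ae ?_)
        filter_upwards [Measure.ae_ne volume (0 : EuclideanSpace ℝ (Fin n))] with u hu
        rw [← ofReal_norm, ENNReal.ofReal_rpow_of_pos (norm_pos_iff.2 hu),
          Real.enorm_of_nonneg (by positivity)]
    _ < ⊤ := hloc.2

end Euclidean

section Operator

variable {X : Type*} [EMetricSpace X] [MeasurableSpace X] {n : ℕ} {α p q : ℝ} {μ : Measure X}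

theorem eLpNorm_potential_le_sharpConst_mul (hp : 0 < p) {F : X → ℝ}
    (hF : MemLp F (ENNReal.ofReal p) μ) :
    eLpNorm (potential n α μ F) (ENNReal.ofReal q) μ ≤
      sharpConst n α p q μ * eLpNorm F (ENNReal.ofReal p) μ := by
  by_cases h0 : eLpNorm F (ENNReal.ofReal p) μ = 0
  · have hF0 : F =ᵐ[μ] 0 := (eLpNorm_eq_zero_iff hF.1 (by simpa using hp)).1 h0
    have : potential n α μ F = 0 := by
      ext x
      refine integral_eq_zero_of_ae ?_
      filter_upwards [hF0] with y hy
      simp [hy]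
    simp [this]
  · rw [← ENNReal.div_le_iff_le_mul (.inl h0) (.inl hF.2.ne)]
    exact le_iSup_of_le F (le_iSup_of_le hF (le_iSup_of_le h0 le_rfl))

end Operator

/-! ### Transplantation of functions -/

section Transplant

variable {X : Type*} [EMetricSpace X] [MeasurableSpace X] [BorelSpace X] {n : ℕ}
  {α p q : ℝ} {μ : Measure X} {e : OpenPartialHomeomorph X (EuclideanSpace ℝ (Fin n))} {R : ℝ}
  {a m₁ m₂ : ℝ≥0∞}

theorem IsNearlyEuclidean.measurableSet_image (he : IsNearlyEuclidean μ e R a m₁ m₂) :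
    MeasurableSet (e.symm '' Metric.ball 0 R) :=
  (e.symm.isOpen_image_of_subset_source Metric.isOpen_ball he.ball_subset).measurableSet

theorem IsNearlyEuclidean.lintegral_map (he : IsNearlyEuclidean μ e R a m₁ m₂) {H : X → ℝ≥0∞}
    (hH : Measurable H) :
    ∫⁻ y, H y ∂((volume.restrict (Metric.ball 0 R)).map e.symm) =
      ∫⁻ z in Metric.ball 0 R, H (e.symm z) :=
  lintegral_map' hH.aemeasurable
    ((e.continuousOn_symm.mono he.ball_subset).aemeasurable measurableSet_ball)

theorem IsNearlyEuclidean.setLIntegral_image_le (he : IsNearlyEuclidean μ e R a m₁ m₂)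
    {H : X → ℝ≥0∞} (hH : Measurable H) :
    ∫⁻ y in e.symm '' Metric.ball 0 R, H y ∂μ ≤ m₁ * ∫⁻ z in Metric.ball 0 R, H (e.symm z) := by
  rw [← he.lintegral_map hH, ← smul_eq_mul, ← lintegral_smul_measure]
  exact lintegral_mono' he.restrict_le le_rfl

theorem IsNearlyEuclidean.le_setLIntegral_image (he : IsNearlyEuclidean μ e R a m₁ m₂)
    {H : X → ℝ≥0∞} (hH : Measurable H) :
    ∫⁻ z in Metric.ball 0 R, H (e.symm z) ≤ m₂ * ∫⁻ y in e.symm '' Metric.ball 0 R, H y ∂μ := by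
  rw [← he.lintegral_map hH, ← smul_eq_mul, ← lintegral_smul_measure]
  exact lintegral_mono' he.map_le le_rfl

open Classical in
/-- The chart on the image of the ball of radius `R`, extended by zero: unlike `e` itself, it is
measurable on the whole space. -/
def chartExtend (e : OpenPartialHomeomorph X (EuclideanSpace ℝ (Fin n))) (R : ℝ) :
    X → EuclideanSpace ℝ (Fin n) :=
  (e.symm '' Metric.ball 0 R).piecewise e 0

open Classical in
theorem IsNearlyEuclidean.measurable_chartExtend (he : IsNearlyEuclidean μ e R a m₁ m₂) :
    Measurable (chartExtend e R) := by
  refine ContinuousOn.measurable_piecewise (e.continuousOn.mono ?_) continuousOn_const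
    he.measurableSet_image
  rintro _ ⟨z, hz, rfl⟩
  exact e.map_target (he.ball_subset hz)

omit [BorelSpace X] in
open Classical in
theorem IsNearlyEuclidean.chartExtend_symm (he : IsNearlyEuclidean μ e R a m₁ m₂)
    {z : EuclideanSpace ℝ (Fin n)} (hz : z ∈ Metric.ball 0 R) :
    chartExtend e R (e.symm z) = z := by
  rw [chartExtend, piecewise_eq_of_mem _ _ _ (mem_image_of_mem _ hz),
    e.right_inv (he.ball_subset hz)]

/-- A function `g` on Euclidean space, moved to `X` by the chart over the ball of radius `R` and
extended by zero. -/
def transplant (e : OpenPartialHomeomorph X (EuclideanSpace ℝ (Fin n))) (R : ℝ)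
    (g : EuclideanSpace ℝ (Fin n) → ℝ≥0) : X → ℝ :=
  (e.symm '' Metric.ball 0 R).indicator fun y ↦ (g (chartExtend e R y) : ℝ)

variable {g : EuclideanSpace ℝ (Fin n) → ℝ≥0}

theorem IsNearlyEuclidean.measurable_transplant (he : IsNearlyEuclidean μ e R a m₁ m₂)
    (hg : Measurable g) : Measurable (transplant e R g) :=
  (hg.comp he.measurable_chartExtend).coe_nnreal_real.indicator he.measurableSet_image

theorem IsNearlyEuclidean.eLpNorm_transplant_le (he : IsNearlyEuclidean μ e R a m₁ m₂)
    (hg : Measurable g) (hp : 0 < p) :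
    eLpNorm (transplant e R g) (ENNReal.ofReal p) μ ≤
      m₁ ^ (1 / p) * (∫⁻ z in Metric.ball 0 R, (g z : ℝ≥0∞) ^ p) ^ (1 / p) := by
  rw [eLpNorm_eq_lintegral_rpow_enorm_toReal (by simpa using hp) ENNReal.ofReal_ne_top,
    ENNReal.toReal_ofReal hp.le, ← ENNReal.mul_rpow_of_nonneg _ _ (by positivity)]
  gcongr
  have h1 : ∀ y, ‖transplant e R g y‖ₑ ^ p = (e.symm '' Metric.ball 0 R).indicator
      (fun y ↦ (g (chartExtend e R y) : ℝ≥0∞) ^ p) y := by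
    intro y
    by_cases hy : y ∈ e.symm '' Metric.ball 0 R
    · rw [transplant, indicator_of_mem hy, indicator_of_mem hy]
      simp
    · rw [transplant, indicator_of_notMem hy, indicator_of_notMem hy]
      simp [hp]
  simp_rw [h1]
  rw [lintegral_indicator he.measurableSet_image]
  refine (he.setLIntegral_image_le
    ((hg.comp he.measurable_chartExtend).coe_nnreal_ennreal.pow_const p)).trans_eq ?_
  congr 1
  refine setLIntegral_congr_fun measurableSet_ball fun z hz ↦ ?_
  simp only [Function.comp_apply, he.chartExtend_symm hz]

/-- The potential of a transplanted function controls the transplanted potential. -/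
theorem IsNearlyEuclidean.lpotential_le (he : IsNearlyEuclidean μ e R a m₁ m₂)
    (ha0 : a ≠ 0) (ha : a ≠ ⊤) (hm₁ : m₁ ≠ ⊤) (hα : 0 < α) (hαn : α < n)
    (hg : Measurable g) {C : ℝ≥0} (hgC : ∀ z, g z ≤ C)
    (hgR : ∀ z ∉ Metric.ball 0 R, g z = 0) {z : EuclideanSpace ℝ (Fin n)}
    (hz : z ∈ Metric.ball 0 R) :
    lpotential α (fun w ↦ g w) z ≤
      a ^ (n - α) * m₂ * ‖potential n α μ (transplant e R g) (e.symm z)‖ₑ := by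
  have hn : 1 ≤ n := by
    have : (0 : ℝ) < n := hα.trans hαn
    exact_mod_cast this
  have : Nonempty (Fin n) := ⟨⟨0, hn⟩⟩
  set k : X → ℝ := fun y ↦ (edist (e.symm z) y ^ (α - n)).toReal with hk
  have hkm : Measurable k := (measurable_edist_right.pow_const _).ennreal_toReal
  set H : X → ℝ≥0∞ := fun y ↦ g (chartExtend e R y) * ENNReal.ofReal (k y) with hH
  have hHm : Measurable H :=
    (hg.comp he.measurable_chartExtend).coe_nnreal_ennreal.mul hkm.ennreal_ofReal
  have hHsymm : ∀ w ∈ Metric.ball 0 R, H (e.symm w) = g w * ENNReal.ofReal (k (e.symm w)) :=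
    fun w hw ↦ by simp only [hH, he.chartExtend_symm hw]
  set I := ∫⁻ y in e.symm '' Metric.ball 0 R, H y ∂μ with hI
  have hpot : potential n α μ (transplant e R g) (e.symm z) = I.toReal := by
    rw [potential, integral_eq_lintegral_of_nonneg_ae]
    · rw [hI, ← lintegral_indicator he.measurableSet_image]
      congr 2
      ext y
      by_cases hy : y ∈ e.symm '' Metric.ball 0 R
      · rw [transplant, indicator_of_mem hy, indicator_of_mem hy,
          ENNReal.ofReal_mul (NNReal.coe_nonneg _), ENNReal.ofReal_coe_nnreal]
      · rw [transplant, indicator_of_notMem hy, indicator_of_notMem hy]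
        simp
    · refine ae_of_all _ fun y ↦ mul_nonneg ?_ ENNReal.toReal_nonneg
      exact indicator_nonneg (fun _ _ ↦ NNReal.coe_nonneg _) _
    · exact ((he.measurable_transplant hg).mul hkm).aestronglyMeasurable
  -- the integral converges, so that the potential is not the junk value of a divergent integral
  have hIfin : I ≠ ⊤ := by
    obtain ⟨c, hc0, hc, hcle⟩ := he.le_edist
    refine ne_top_of_le_ne_top ?_ (he.setLIntegral_image_le hHm)
    refine ENNReal.mul_ne_top hm₁ (ne_top_of_le_ne_top ?_ (setLIntegral_mono' measurableSet_ball
      (g := fun w ↦ (C * c ^ (α - n)) * edist z w ^ (α - n)) fun w hw ↦ ?_))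
    · rw [lintegral_const_mul' _ _ (by finiteness)]
      exact ENNReal.mul_ne_top (by finiteness) (setLIntegral_edist_rpow_lt_top hα hn z R).ne
    · rw [hHsymm w hw, mul_assoc]
      gcongr
      · exact hgC w
      · rw [← ENNReal.mul_rpow_of_ne_top hc (edist_ne_top _ _)]
        refine ENNReal.ofReal_toReal_le.trans ?_
        exact rpow_le_rpow_of_nonpos (by linarith) (hcle z hz w hw)
  have hlow : a ^ (α - n) * lpotential α (fun w ↦ g w) z ≤ m₂ * I := by
    refine le_trans ?_ (he.le_setLIntegral_image hHm)
    rw [lpotential, ← lintegral_const_mul' _ _ (by finiteness),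
      ← lintegral_indicator measurableSet_ball]
    refine lintegral_mono_ae ?_
    -- on the diagonal the kernel is infinite on the Euclidean side and `∞.toReal = 0` on `X`
    filter_upwards [Measure.ae_ne volume z] with w hw
    by_cases hwR : w ∈ Metric.ball 0 R
    · rw [indicator_of_mem hwR, hHsymm w hwR, mul_left_comm,
        ← ENNReal.mul_rpow_of_ne_top ha (edist_ne_top _ _)]
      gcongr
      have hne : edist (e.symm z) (e.symm w) ≠ 0 := by
        rw [Ne, edist_eq_zero]
        exact fun h ↦ hw (e.symm.injOn (he.ball_subset hz) (he.ball_subset hwR) h).symm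
      have hle := he.edist_le z hz w hwR
      have htop : edist (e.symm z) (e.symm w) ≠ ⊤ :=
        ne_top_of_le_ne_top (ENNReal.mul_ne_top ha (edist_ne_top _ _)) hle
      rw [hk, ENNReal.ofReal_toReal (ENNReal.rpow_ne_top_of_ne_zero hne htop)]
      exact rpow_le_rpow_of_nonpos (by linarith) hle
    · simp [hgR w hwR]
  rw [hpot, Real.enorm_of_nonneg ENNReal.toReal_nonneg, ENNReal.ofReal_toReal hIfin, mul_assoc]
  calc lpotential α (fun w ↦ g w) z
      = a ^ (n - α) * (a ^ (α - n) * lpotential α (fun w ↦ g w) z) := by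
        rw [← mul_assoc, ← ENNReal.rpow_add _ _ ha0 ha]
        simp
    _ ≤ _ := by gcongr

theorem IsNearlyEuclidean.setLIntegral_lpotential_le (he : IsNearlyEuclidean μ e R a m₁ m₂)
    (ha0 : a ≠ 0) (ha : a ≠ ⊤) (hm₁ : m₁ ≠ ⊤) (hm₂ : m₂ ≠ ⊤) (hα : 0 < α) (hαn : α < n)
    (hp : 0 < p) (hq : 0 < q)
    (hg : Measurable g) {C : ℝ≥0} (hgC : ∀ z, g z ≤ C)
    (hgR : ∀ z ∉ Metric.ball 0 R, g z = 0) :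
    (∫⁻ z in Metric.ball 0 R, lpotential α (fun w ↦ g w) z ^ q) ^ (1 / q) ≤
      m₂ ^ (1 / q) * (a ^ (n - α) * m₂) * m₁ ^ (1 / p) * (sharpConst n α p q μ *
        (∫⁻ z in Metric.ball 0 R, (g z : ℝ≥0∞) ^ p) ^ (1 / p)) := by
  have hmem : MemLp (transplant e R g) (ENNReal.ofReal p) μ := by
    refine ⟨(he.measurable_transplant hg).aestronglyMeasurable,
      (he.eLpNorm_transplant_le hg hp).trans_lt ?_⟩
    have hint : ∫⁻ z in Metric.ball 0 R, (g z : ℝ≥0∞) ^ p ≠ ⊤ := by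
      refine ne_top_of_le_ne_top ?_ (lintegral_mono
        (g := fun _ ↦ (C : ℝ≥0∞) ^ p) fun z ↦ ?_)
      · rw [setLIntegral_const]
        exact ENNReal.mul_ne_top (by finiteness) measure_ball_lt_top.ne
      · exact ENNReal.rpow_le_rpow (by exact_mod_cast hgC z) hp.le
    have : 0 ≤ 1 / p := by positivity
    finiteness
  set F := potential n α μ (transplant e R g)
  set P := lpotential α (fun w ↦ (g w : ℝ≥0∞))
  have hP : Measurable P := measurable_lpotential hg.coe_nnreal_ennreal
  have h1 : ∫⁻ z in Metric.ball 0 R, P z ^ q ≤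
      m₂ * ((a ^ (n - α) * m₂) ^ q * ∫⁻ y, ‖F y‖ₑ ^ q ∂μ) := by
    calc ∫⁻ z in Metric.ball 0 R, P z ^ q
        = ∫⁻ z in Metric.ball 0 R, P (chartExtend e R (e.symm z)) ^ q := by
          refine setLIntegral_congr_fun measurableSet_ball fun z hz ↦ ?_
          simp only [he.chartExtend_symm hz]
      _ ≤ m₂ * ∫⁻ y in e.symm '' Metric.ball 0 R, P (chartExtend e R y) ^ q ∂μ :=
          he.le_setLIntegral_image ((hP.comp he.measurable_chartExtend).pow_const q)
      _ ≤ m₂ * ∫⁻ y in e.symm '' Metric.ball 0 R, (a ^ (n - α) * m₂) ^ q * ‖F y‖ₑ ^ q ∂μ := by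
          gcongr 1
          refine setLIntegral_mono' he.measurableSet_image ?_
          rintro _ ⟨z, hz, rfl⟩
          rw [he.chartExtend_symm hz, ← ENNReal.mul_rpow_of_nonneg _ _ hq.le]
          gcongr
          exact he.lpotential_le ha0 ha hm₁ hα hαn hg hgC hgR hz
      _ ≤ m₂ * ∫⁻ y, (a ^ (n - α) * m₂) ^ q * ‖F y‖ₑ ^ q ∂μ := by
          gcongr
          exact Measure.restrict_le_self
      _ = _ := by
          have hna : 0 ≤ n - α := by linarith
          rw [lintegral_const_mul' _ _ (by finiteness)]
  have h2 : (∫⁻ y, ‖F y‖ₑ ^ q ∂μ) ^ (1 / q) = eLpNorm F (ENNReal.ofReal q) μ := by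
    rw [eLpNorm_eq_lintegral_rpow_enorm_toReal (by simpa using hq) ENNReal.ofReal_ne_top,
      ENNReal.toReal_ofReal hq.le]
  have hq' : 0 ≤ 1 / q := by positivity
  calc (∫⁻ z in Metric.ball 0 R, P z ^ q) ^ (1 / q)
      ≤ (m₂ * ((a ^ (n - α) * m₂) ^ q * ∫⁻ y, ‖F y‖ₑ ^ q ∂μ)) ^ (1 / q) := by gcongr
    _ = m₂ ^ (1 / q) * (a ^ (n - α) * m₂) * eLpNorm F (ENNReal.ofReal q) μ := by
        rw [ENNReal.mul_rpow_of_nonneg _ _ hq', ENNReal.mul_rpow_of_nonneg _ _ hq', h2,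
          ← ENNReal.rpow_mul, mul_one_div_cancel hq.ne', ENNReal.rpow_one]
        ring
    _ ≤ m₂ ^ (1 / q) * (a ^ (n - α) * m₂) * (sharpConst n α p q μ *
          (m₁ ^ (1 / p) * (∫⁻ z in Metric.ball 0 R, (g z : ℝ≥0∞) ^ p) ^ (1 / p))) := by
        gcongr
        exact (eLpNorm_potential_le_sharpConst_mul hp hmem).trans
          (by gcongr; exact he.eLpNorm_transplant_le hg hp)
    _ = _ := by ring

end Transplant

/-! ### Reduction to bounded functions of bounded support -/

section Truncation

variable {n : ℕ} {α p q : ℝ}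

/-- If the inequality with constant `N` holds over balls for bounded functions supported in the
ball, it holds for all functions in `L^p`, by truncation. -/
theorem eLpNorm_potential_le_of_bounded (hp : 0 < p) (hq : 0 < q) {N : ℝ≥0∞}
    (h : ∀ R > 0, ∀ (C : ℝ≥0) (g : EuclideanSpace ℝ (Fin n) → ℝ≥0), Measurable g →
      (∀ z, g z ≤ C) → (∀ z ∉ Metric.ball 0 R, g z = 0) →
      (∫⁻ z in Metric.ball 0 R, lpotential α (fun w ↦ g w) z ^ q) ^ (1 / q) ≤
        N * (∫⁻ z in Metric.ball 0 R, (g z : ℝ≥0∞) ^ p) ^ (1 / p))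
    {f : EuclideanSpace ℝ (Fin n) → ℝ} (hf : AEStronglyMeasurable f volume) :
    eLpNorm (potential n α volume f) (ENNReal.ofReal q) volume ≤
      N * eLpNorm f (ENNReal.ofReal p) volume := by
  set f' := hf.mk f
  have hff' : f =ᵐ[volume] f' := hf.ae_eq_mk
  have hf'm : Measurable f' := hf.stronglyMeasurable_mk.measurable
  have hpot : potential n α volume f = potential n α volume f' := by
    ext x
    refine integral_congr_ae ?_
    filter_upwards [hff'] with y hy
    rw [hy]
  rw [hpot, eLpNorm_congr_ae hff']
  set g : ℕ → EuclideanSpace ℝ (Fin n) → ℝ≥0 := fun k ↦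
    (Metric.ball 0 (k + 1)).indicator fun w ↦ min ‖f' w‖₊ k with hg
  have hgm : ∀ k, Measurable (g k) := fun k ↦
    (hf'm.nnnorm.min measurable_const).indicator measurableSet_ball
  have hgle : ∀ k w, g k w ≤ min ‖f' w‖₊ k := fun k w ↦ indicator_le_self _ _ _
  have hgmono : ∀ w, Monotone fun k ↦ g k w := by
    intro w i j hij
    refine indicator_le_indicator_of_subset (Metric.ball_subset_ball (by gcongr))
      (fun _ ↦ bot_le) w |>.trans (indicator_le_indicator ?_)
    gcongr
  have hball : ∀ w : EuclideanSpace ℝ (Fin n), ∀ᶠ k : ℕ in atTop,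
      w ∈ Metric.ball (0 : EuclideanSpace ℝ (Fin n)) (k + 1) := by
    intro w
    filter_upwards [eventually_ge_atTop ⌈‖w‖⌉₊] with k hk
    rw [mem_ball_zero_iff]
    linarith [Nat.ceil_le.1 hk]
  have hgev : ∀ w, ∀ᶠ k in atTop, g k w = ‖f' w‖₊ := by
    intro w
    filter_upwards [hball w, eventually_ge_atTop ⌈‖f' w‖₊⌉₊] with k hk hk'
    rw [hg]
    simp only [indicator_of_mem hk]
    exact min_eq_left (Nat.ceil_le.1 hk')
  have hPlim : ∀ z, Tendsto (fun k ↦ lpotential α (fun w ↦ g k w) z) atTop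
      (𝓝 (lpotential α (fun w ↦ ‖f' w‖ₑ) z)) := by
    intro z
    refine lintegral_tendsto_of_tendsto_of_monotone (fun k ↦ ?_) (ae_of_all _ fun w i j hij ↦ ?_)
      (ae_of_all _ fun w ↦ ?_)
    · exact ((hgm k).coe_nnreal_ennreal.mul (measurable_edist_right.pow_const _)).aemeasurable
    · have := hgmono w hij
      simp only at this ⊢
      gcongr
    · refine tendsto_const_nhds.congr' ?_
      filter_upwards [hgev w] with k hk
      rw [hk, enorm_eq_nnnorm]
  have hle : ∀ z, ‖potential n α volume f' z‖ₑ ≤ lpotential α (fun w ↦ ‖f' w‖ₑ) z := by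
    intro z
    refine (enorm_integral_le_lintegral_enorm _).trans (lintegral_mono fun w ↦ ?_)
    rw [enorm_mul]
    gcongr
    rw [Real.enorm_of_nonneg ENNReal.toReal_nonneg]
    exact ENNReal.ofReal_toReal_le
  set B := N * eLpNorm f' (ENNReal.ofReal p) volume
  have hstep : ∀ k : ℕ, ∫⁻ z in Metric.ball 0 ((k : ℝ) + 1), lpotential α (fun w ↦ g k w) z ^ q ≤
      B ^ q := by
    intro k
    have h1 := h (k + 1) (by positivity) k (g k) (hgm k)
      (fun z ↦ (hgle k z).trans (min_le_right _ _)) fun z hz ↦ indicator_of_notMem hz _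
    have h2 : (∫⁻ z in Metric.ball 0 ((k : ℝ) + 1), (g k z : ℝ≥0∞) ^ p) ^ (1 / p) ≤
        eLpNorm f' (ENNReal.ofReal p) volume := by
      rw [eLpNorm_eq_lintegral_rpow_enorm_toReal (by simpa using hp) ENNReal.ofReal_ne_top,
        ENNReal.toReal_ofReal hp.le]
      refine ENNReal.rpow_le_rpow ?_ (by positivity)
      refine (lintegral_mono fun z ↦ ?_).trans (lintegral_mono' Measure.restrict_le_self le_rfl)
      refine ENNReal.rpow_le_rpow ?_ hp.le
      rw [enorm_eq_nnnorm]
      exact_mod_cast (hgle k z).trans (min_le_left _ _)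
    have h3 := h1.trans (mul_le_mul_right h2 N)
    rwa [one_div, ENNReal.rpow_inv_le_iff hq] at h3
  have hfinal : ∫⁻ z, ‖potential n α volume f' z‖ₑ ^ q ≤ B ^ q := by
    calc ∫⁻ z, ‖potential n α volume f' z‖ₑ ^ q
        ≤ ∫⁻ z, liminf (fun k : ℕ ↦ (Metric.ball 0 ((k : ℝ) + 1)).indicator
            (fun z ↦ lpotential α (fun w ↦ g k w) z ^ q) z) atTop := by
          refine lintegral_mono fun z ↦ ?_
          have hlim : Tendsto (fun k : ℕ ↦ (Metric.ball 0 ((k : ℝ) + 1)).indicator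
              (fun z ↦ lpotential α (fun w ↦ g k w) z ^ q) z) atTop
              (𝓝 (lpotential α (fun w ↦ ‖f' w‖ₑ) z ^ q)) := by
            refine ((ENNReal.continuous_rpow_const.tendsto _).comp (hPlim z)).congr' ?_
            filter_upwards [hball z] with k hk
            rw [indicator_of_mem hk, Function.comp_apply]
          rw [hlim.liminf_eq]
          exact ENNReal.rpow_le_rpow (hle z) hq.le
      _ ≤ liminf (fun k : ℕ ↦ ∫⁻ z, (Metric.ball 0 ((k : ℝ) + 1)).indicator
            (fun z ↦ lpotential α (fun w ↦ g k w) z ^ q) z) atTop :=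
          lintegral_liminf_le fun k ↦ ((measurable_lpotential
            (hgm k).coe_nnreal_ennreal).pow_const q).indicator measurableSet_ball
      _ ≤ B ^ q := by
          refine liminf_le_of_frequently_le' (Frequently.of_forall fun k ↦ ?_)
          rw [lintegral_indicator measurableSet_ball]
          exact hstep k
  rw [eLpNorm_eq_lintegral_rpow_enorm_toReal (by simpa using hq) ENNReal.ofReal_ne_top,
    ENNReal.toReal_ofReal hq.le, one_div, ENNReal.rpow_inv_le_iff hq]
  exact hfinal

end Truncation

/-! ### Comparison of the sharp constants -/

section Comparison

variable {X : Type*} [EMetricSpace X] [MeasurableSpace X] [BorelSpace X] {n : ℕ}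
  {α p q : ℝ} {μ : Measure X}

/-- With the exponents of the Hardy-Littlewood-Sobolev inequality, the powers of the scale `t`
cancel in the constant of `IsNearlyEuclidean.setLIntegral_lpotential_le`. -/
theorem distortion_const_eq {K t : ℝ} (hK : 0 < K) (ht : 0 < t)
    (hpq : 1 / q = 1 / p - α / n) (hn : (n : ℝ) ≠ 0) :
    ENNReal.ofReal (K * (t ^ n)⁻¹) ^ (1 / q) *
        (ENNReal.ofReal (K * t) ^ (n - α) * ENNReal.ofReal (K * (t ^ n)⁻¹)) *
        ENNReal.ofReal (K * t ^ n) ^ (1 / p) =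
      ENNReal.ofReal (K ^ (1 / q + (n - α) + 1 + 1 / p)) := by
  rw [ENNReal.ofReal_rpow_of_pos (by positivity), ENNReal.ofReal_rpow_of_pos (by positivity),
    ENNReal.ofReal_rpow_of_pos (by positivity), ← ENNReal.ofReal_mul (by positivity),
    ← ENNReal.ofReal_mul (by positivity), ← ENNReal.ofReal_mul (by positivity)]
  congr 1
  have ht' : t ^ n = t ^ (n : ℝ) := (Real.rpow_natCast t n).symm
  have hti : (t ^ n)⁻¹ = t ^ (-n : ℝ) := by rw [ht', Real.rpow_neg ht.le]
  rw [hti, ht', Real.mul_rpow hK.le (by positivity), Real.mul_rpow hK.le (by positivity),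
    Real.mul_rpow hK.le (by positivity), ← Real.rpow_mul ht.le, ← Real.rpow_mul ht.le,
    Real.rpow_add hK, Real.rpow_add hK, Real.rpow_add hK, Real.rpow_one]
  have hexp : t ^ (-n * (1 / q) : ℝ) * t ^ (n - α) * t ^ (-n : ℝ) * t ^ (n * (1 / p) : ℝ) = 1 := by
    rw [← Real.rpow_add ht, ← Real.rpow_add ht, ← Real.rpow_add ht,
      show -n * (1 / q) + (n - α) + -n + n * (1 / p) = (0 : ℝ) by
        rw [hpq]; field_simp; ring, Real.rpow_zero]
  calc _ = K ^ (1 / q) * K ^ (n - α) * K * K ^ (1 / p) *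
        (t ^ (-n * (1 / q) : ℝ) * t ^ (n - α) * t ^ (-n : ℝ) * t ^ (n * (1 / p) : ℝ)) := by ring
    _ = _ := by rw [hexp, mul_one]

/-- A metric measure space containing rescaled almost Euclidean balls of all sizes has at least the
sharp constant of Euclidean space. -/
theorem sharpConst_volume_le (hα : 0 < α) (hαn : α < n) (hp : 0 < p) (hq : 0 < q)
    (hpq : 1 / q = 1 / p - α / n)
    (h : ∀ K : ℝ, 1 < K → ∀ R : ℝ, 0 < R →
      ∃ (e : OpenPartialHomeomorph X (EuclideanSpace ℝ (Fin n))) (t : ℝ), 0 < t ∧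
        IsNearlyEuclidean μ e R (ENNReal.ofReal (K * t))
          (ENNReal.ofReal (K * t ^ n)) (ENNReal.ofReal (K * (t ^ n)⁻¹))) :
    sharpConst n α p q (volume : Measure (EuclideanSpace ℝ (Fin n))) ≤ sharpConst n α p q μ := by
  have hn : (n : ℝ) ≠ 0 := (hα.trans hαn).ne'
  refine iSup_le fun f ↦ iSup_le fun hf ↦ iSup_le fun _ ↦ ENNReal.div_le_of_le_mul ?_
  refine eLpNorm_potential_le_of_bounded hp hq (fun R hR C g hg hgC hgR ↦ ?_) hf.1
  set s := 1 / q + (n - α) + 1 + 1 / p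
  set A := sharpConst n α p q μ *
    (∫⁻ z in Metric.ball 0 R, (g z : ℝ≥0∞) ^ p) ^ (1 / p)
  have hlim : Tendsto (fun K : ℝ ↦ ENNReal.ofReal (K ^ s) * A) (𝓝[>] 1) (𝓝 A) := by
    have h1 : Tendsto (fun K : ℝ ↦ ENNReal.ofReal (K ^ s)) (𝓝[>] 1) (𝓝 1) := by
      have : ContinuousAt (fun K : ℝ ↦ K ^ s) 1 :=
        Real.continuousAt_rpow_const _ _ (.inl one_ne_zero)
      have h2 := (ENNReal.continuous_ofReal.tendsto _).comp this.tendsto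
      simp only [Real.one_rpow, ENNReal.ofReal_one] at h2
      exact h2.mono_left nhdsWithin_le_nhds
    simpa using ENNReal.Tendsto.mul_const h1 (.inl one_ne_zero) (b := A)
  refine ge_of_tendsto hlim ?_
  filter_upwards [self_mem_nhdsWithin] with K hK
  have hK0 : 0 < K := zero_lt_one.trans hK
  obtain ⟨e, t, ht, he⟩ := h K hK R hR
  have := he.setLIntegral_lpotential_le (by simp; positivity) ENNReal.ofReal_ne_top
    ENNReal.ofReal_ne_top ENNReal.ofReal_ne_top hα hαn hp hq hg hgC hgR
  rwa [distortion_const_eq hK0 ht hpq hn] at this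

end Comparison

end HLS

end

theorem proposition1p2 {n : ℕ} {M : Type*} [EMetricSpace M] [CompactSpace M] [Nonempty M]
    [ChartedSpace (EuclideanSpace ℝ (Fin n)) M] [IsManifold (𝓡 n) ∞ M]
    [RiemannianBundle (fun x : M ↦ TangentSpace (𝓡 n) x)]
    [IsContMDiffRiemannianBundle (𝓡 n) ∞ (EuclideanSpace ℝ (Fin n))
      (fun x : M ↦ TangentSpace (𝓡 n) x)]
    [IsRiemannianManifold (𝓡 n) M]
    [MeasurableSpace M] [BorelSpace M]
    (α p q : ℝ) (hα : 0 < α) (hαn : α < n) (hp : 1 < p) (hpn : p < n / α)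
    (hq : 1 / q = 1 / p - α / n) :
    HLS.sharpConst n α p q (volume : Measure (EuclideanSpace ℝ (Fin n))) ≤
      HLS.sharpConst n α p q (HLS.riemannianVolume n M) := by
  have hp0 : 0 < p := zero_lt_one.trans hp
  have hq0 : 0 < q := by
    rw [← one_div_pos, hq, sub_pos, div_lt_div_iff₀ (hα.trans hαn) hp0, one_mul, mul_comm]
    exact (lt_div_iff₀ hα).1 hpn
  exact HLS.sharpConst_volume_le hα hαn hp0 hq0 hq fun K hK R hR ↦
    HLS.exists_isNearlyEuclidean (Classical.arbitrary M) hK hR
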